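/- Let $\mathbb K\in\{\mathbb R,\mathbb C\}$; all Banach spaces are over $\mathbb K$, and an operator is a bounded linear map. For a Banach space $X$, a weak$^*$-compact set $K\subset X^*$ and $\varepsilon>0$, let $s_\varepsilon(K)$ be the set of all $x^*\in K$ such that $\operatorname{diam}(V\cap K)>\varepsilon$ (norm diameter) for every weak$^*$-neighborhood $V$ of $x^*$. Put $s^0_\varepsilon(K)=K$, $s^{\zeta+1}_\varepsilon(K)=s_\varepsilon(s^\zeta_\varepsilon(K))$, and $s^\zeta_\varepsilon(K)=\bigcap_{\eta<\zeta}s^\eta_\varepsilon(K)$ for a limit ordinal $\zeta$; for $\varepsilon\leqslant 0$ put $s^\zeta_\varepsilon(K)=K$ for every $\zeta$. For an ordinal $\xi$ and $1\leqslant q<\infty$, the set $K$ has $\xi$-$q$-summable Szlenk index if there is $M\geqslant 0$ such that for all $n$ and all $\varepsilon_1,\dots,\varepsilon_n\geqslant 0$, $$s^{\omega^\xi}_{\varepsilon_1}\cdots s^{\omega^\xi}_{\varepsilon_n}(K)\neq\varnothing\quad\Longrightarrow\quad\sum_{i=1}^n\varepsilon_i^q\leqslant M^q .$$ An operator $A:X\to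 Y$ has $\xi$-$q$-summable Szlenk index if the set $A^*B_{Y^*}$ does, where $B_{Y^*}$ is the closed unit ball of $Y^*$. The injective tensor product $X\hat\otimes_\varepsilon Y$ is the closed linear span, in the space of operators $Y^*\to X$ with the operator norm, of the operators $x\otimes y:y^*\mapsto y^*(y)x$. For operators $A_i:X_i\to Y_i$, $i=0,1$, the induced operator $A_0\otimes A_1:X_0\hat\otimes_\varepsilon X_1\to Y_0\hat\otimes_\varepsilon Y_1$ is given by $(A_0\otimes A_1)(u)=A_0uA_1^*$. **Corollary.** Let $\xi$ be an ordinal, let $1\leqslant q<\infty$, and let $A_0:X_0\to Y_0$ and $A_1:X_1\to Y_1$ be operators between Banach spaces. If $A_0$ and $A_1$ have $\xi$-$q$-summable Szlenk index, then so does $A_0\otimes A_1:X_0\hat\otimes_\varepsilon X_1\to Y_0\hat\otimes_\varepsilon Y_1$. -/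

import Mathlib

open scoped Ordinal Topology

noncomputable section

namespace Szlenk

section Derivations

variable {𝕜 : Type*} [RCLike 𝕜]
variable {X : Type*} [NormedAddCommGroup X] [NormedSpace 𝕜 X]
variable {Y : Type*} [NormedAddCommGroup Y] [NormedSpace 𝕜 Y]

/-- The Szlenk derivation `s_ε(K)`, for `ε > 0`: the points `x` of `K` such that every
weak* neighbourhood `V` of `x` satisfies `diam (V ∩ K) > ε`, where the diameter is taken with
respect to the norm of the dual space. -/
def pointDeriv (ε : ℝ) (K : Set (WeakDual 𝕜 X)) : Set (WeakDual 𝕜 X) :=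
  {x ∈ K | ∀ V ∈ 𝓝 x,
    ENNReal.ofReal ε < Metric.ediam (WeakDual.toStrongDual '' (V ∩ K))}

/-- The transfinite Szlenk derivation `s_ε^ξ(K)`, with the convention `s_ε^ξ(K) = K` for
`ε ≤ 0`. -/
def iterDeriv (ε : ℝ) (ξ : Ordinal) (K : Set (WeakDual 𝕜 X)) : Set (WeakDual 𝕜 X) :=
  if ε ≤ 0 then K
  else Ordinal.limitRecOn ξ K (fun _ L => pointDeriv ε L)
    (fun ζ _ L => ⋂ (η : Ordinal) (h : η < ζ), L η h)

/-- `multiDeriv ξ [ε₁, …, εₙ] K` is `s_{ε₁}^{ω^ξ} … s_{εₙ}^{ω^ξ}(K)`. -/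
def multiDeriv (ξ : Ordinal) (l : List ℝ) (K : Set (WeakDual 𝕜 X)) : Set (WeakDual 𝕜 X) :=
  l.foldr (fun ε L => iterDeriv ε (ω ^ ξ) L) K

/-- `K` has `M`-`ξ`-`q`-summable Szlenk index. -/
def SetSummableWith (M : ℝ) (ξ : Ordinal) (q : ℝ) (K : Set (WeakDual 𝕜 X)) : Prop :=
  ∀ l : List ℝ, (∀ ε ∈ l, 0 ≤ ε) → (multiDeriv ξ l K).Nonempty →
    (l.map fun ε => ε ^ q).sum ≤ M ^ q

/-- `K` has `ξ`-`q`-summable Szlenk index. -/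
def SetSummable (ξ : Ordinal) (q : ℝ) (K : Set (WeakDual 𝕜 X)) : Prop :=
  ∃ M : ℝ, 0 ≤ M ∧ SetSummableWith M ξ q K

/-- The set `A^* B_{Y^*}`, image of the closed unit ball of `Y^*` under the adjoint
`y^* ↦ y^* ∘ A` of `A`. -/
def adjointBall (A : X →L[𝕜] Y) : Set (WeakDual 𝕜 X) :=
  (fun y : StrongDual 𝕜 Y => StrongDual.toWeakDual (y.comp A)) '' Metric.closedBall 0 1

/-- The operator `A` has `ξ`-`q`-summable Szlenk index. -/
def OperatorSummable (ξ : Ordinal) (q : ℝ) (A : X →L[𝕜] Y) : Prop :=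
  SetSummable ξ q (adjointBall A)

end Derivations

section InjectiveTensorProduct

/-- The normed space `𝔏(E, F)` of bounded operators, with the operator norm. -/
abbrev Op (𝕜 E F : Type*) [RCLike 𝕜] [NormedAddCommGroup E] [NormedSpace 𝕜 E]
    [NormedAddCommGroup F] [NormedSpace 𝕜 F] := E →L[𝕜] F

variable {𝕜 : Type*} [RCLike 𝕜]

section

variable {X Y : Type*} [NormedAddCommGroup X] [NormedSpace 𝕜 X]
  [NormedAddCommGroup Y] [NormedSpace 𝕜 Y]

/-- The elementary tensor `x ⊗ y : Y^* → X`, `y^* ↦ y^*(y) x`. -/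
def elemTensor (x : X) (y : Y) : Op 𝕜 (StrongDual 𝕜 Y) X :=
  (ContinuousLinearMap.apply 𝕜 𝕜 y).smulRight x

theorem elemTensor_apply (x : X) (y : Y) (f : StrongDual 𝕜 Y) :
    elemTensor x y f = f y • x := rfl

end

variable (𝕜) in
/-- The injective tensor product of `X` and `Y`: the closed span, in the space of bounded
operators `Y^* → X` with the operator norm, of the elementary tensors. -/
def InjTensor (X Y : Type*) [NormedAddCommGroup X] [NormedSpace 𝕜 X]
    [NormedAddCommGroup Y] [NormedSpace 𝕜 Y] : Submodule 𝕜 (Op 𝕜 (StrongDual 𝕜 Y) X) :=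
  (Submodule.span 𝕜 (Set.range fun p : X × Y => elemTensor p.1 p.2)).topologicalClosure

variable {X₀ X₁ Y₀ Y₁ : Type*}
  [NormedAddCommGroup X₀] [NormedSpace 𝕜 X₀] [NormedAddCommGroup X₁] [NormedSpace 𝕜 X₁]
  [NormedAddCommGroup Y₀] [NormedSpace 𝕜 Y₀] [NormedAddCommGroup Y₁] [NormedSpace 𝕜 Y₁]

/-- The map `u ↦ A₀ u A₁^*` on bounded operators. -/
def sandwich (A₀ : X₀ →L[𝕜] Y₀) (A₁ : X₁ →L[𝕜] Y₁) :
    Op 𝕜 (Op 𝕜 (StrongDual 𝕜 X₁) X₀) (Op 𝕜 (StrongDual 𝕜 Y₁) Y₀) :=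
  (A₀.postcomp (StrongDual 𝕜 Y₁)).comp
    ((A₁.precomp 𝕜 : Op 𝕜 (StrongDual 𝕜 Y₁) (StrongDual 𝕜 X₁)).precomp X₀)

theorem sandwich_apply (A₀ : X₀ →L[𝕜] Y₀) (A₁ : X₁ →L[𝕜] Y₁)
    (u : Op 𝕜 (StrongDual 𝕜 X₁) X₀) (f : StrongDual 𝕜 Y₁) :
    sandwich A₀ A₁ u f = A₀ (u (f.comp A₁)) := rfl

theorem sandwich_elemTensor (A₀ : X₀ →L[𝕜] Y₀) (A₁ : X₁ →L[𝕜] Y₁) (x : X₀) (y : X₁) :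
    sandwich A₀ A₁ (elemTensor x y) = elemTensor (A₀ x) (A₁ y) := by
  ext f
  simp [sandwich_apply, elemTensor_apply]

theorem sandwich_mem (A₀ : X₀ →L[𝕜] Y₀) (A₁ : X₁ →L[𝕜] Y₁) :
    ∀ u ∈ InjTensor 𝕜 X₀ X₁, sandwich A₀ A₁ u ∈ InjTensor 𝕜 Y₀ Y₁ := by
  intro u hu
  refine map_mem_closure (sandwich A₀ A₁).continuous hu ?_
  intro v hv
  have h : Submodule.span 𝕜 (Set.range fun p : X₀ × X₁ => elemTensor p.1 p.2) ≤
      (Submodule.span 𝕜 (Set.range fun p : Y₀ × Y₁ => elemTensor p.1 p.2)).comap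
        (sandwich A₀ A₁).toLinearMap := by
    rw [Submodule.span_le]
    rintro _ ⟨p, rfl⟩
    refine Submodule.subset_span ⟨(A₀ p.1, A₁ p.2), ?_⟩
    exact (sandwich_elemTensor A₀ A₁ p.1 p.2).symm
  exact h hv

/-- The induced operator `A₀ ⊗ A₁`, `u ↦ A₀ u A₁^*`, between injective tensor products. -/
def tensorOp (A₀ : X₀ →L[𝕜] Y₀) (A₁ : X₁ →L[𝕜] Y₁) :
    Op 𝕜 (InjTensor 𝕜 X₀ X₁) (InjTensor 𝕜 Y₀ Y₁) :=
  ((sandwich A₀ A₁).comp (InjTensor 𝕜 X₀ X₁).subtypeL).codRestrict (InjTensor 𝕜 Y₀ Y₁)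
    fun u => sandwich_mem A₀ A₁ u u.2

end InjectiveTensorProduct

end Szlenk

end

/-!
Every functional in the adjoint ball of `A₀ ⊗ A₁` satisfies all the affine inequalities that hold
for the functionals `u ↦ x₀ (u x₁)`, with `x₀`, `x₁` in the adjoint balls `K₀`, `K₁` of `A₀`, `A₁`.
On the compact space `K₀ × K₁`, the derivation `clDeriv` for the maximum of the two distances
splits, over the transfinite steps `ω ^ ξ`, into derivations of `K₀` and of `K₁`. It remains to
compare Szlenk derivations of a weak* closed convex hull with derivations of a generating set.

To do so, put weights on the derived sets of `K₀ × K₁` and consider the affine functions that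
majorize the resulting step function, together with the set of functionals at which they are all
`≥ r`. Raise the weights by `a * b` on the derived sets of level `b`. Then a Szlenk derivation of
level `ε` raises `r` by almost `a * ε / 4`, because a point of the derived set has points nearby
that differ from it by almost `ε / 4` at a vector of the unit ball which almost annihilates a
finite set of functionals given in advance. To pass from `ω ^ ξ` to `ω ^ (ξ + 1)`, take `n` steps,
each with `a / n` in place of `a`: for any fixed `N`, some level is reached in at least `N` of the
`n` steps and is at least the average of their levels, up to an error that vanishes as `n → ∞`.

Hence, if successive Szlenk derivations of levels `εᵢ` leave the adjoint ball nonempty, then for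
arbitrary weights `gᵢ ≥ 0` there are levels `bᵢ` of derivations leaving `K₀ × K₁` nonempty such that
`∑ gᵢ * εᵢ / 4 ≤ ∑ gᵢ * bᵢ`, up to an arbitrarily small error. The weights `gᵢ = εᵢ ^ (q - 1)` and
Young's inequality give the `q`-summability.
-/

noncomputable section

namespace Szlenk

open Set Filter RCLike

section Iteration

variable {Z W : Type*} {D : Set Z → Set Z}

/-- The transfinite iteration of an operation `D` on sets, with intersections at limits. For
`ε > 0`, the derivation `iterDeriv ε` is the transfinite iteration of `pointDeriv ε`. -/
def transIter (D : Set Z → Set Z) (ζ : Ordinal) (A : Set Z) : Set Z :=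
  Ordinal.limitRecOn ζ A (fun _ L => D L) (fun ζ _ L => ⋂ (η : Ordinal) (h : η < ζ), L η h)

@[simp]
theorem transIter_zero (D : Set Z → Set Z) (A : Set Z) : transIter D 0 A = A :=
  Ordinal.limitRecOn_zero _ _ _

theorem transIter_add_one (D : Set Z → Set Z) (ζ : Ordinal) (A : Set Z) :
    transIter D (ζ + 1) A = D (transIter D ζ A) :=
  Ordinal.limitRecOn_add_one _ _ _ _

@[simp]
theorem transIter_one (D : Set Z → Set Z) (A : Set Z) : transIter D 1 A = D A := by
  rw [← zero_add (1 : Ordinal), transIter_add_one, transIter_zero]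

theorem transIter_limit (D : Set Z → Set Z) {ζ : Ordinal} (hζ : Order.IsSuccLimit ζ)
    (A : Set Z) : transIter D ζ A = ⋂ (η : Ordinal) (_ : η < ζ), transIter D η A :=
  Ordinal.limitRecOn_limit _ _ _ _ hζ

theorem transIter_antitone (hD : ∀ A, D A ⊆ A) (A : Set Z) :
    Antitone fun ζ => transIter D ζ A := by
  intro η ζ h
  induction ζ using Ordinal.limitRecOn with
  | zero => rw [le_antisymm h zero_le]
  | add_one ζ ih =>
    rcases h.eq_or_lt with rfl | h
    · rfl
    · simp only [transIter_add_one]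
      exact (hD _).trans (ih (Order.lt_add_one_iff.1 h))
  | limit ζ hζ _ =>
    rcases h.eq_or_lt with rfl | h
    · rfl
    · simp only [transIter_limit D hζ]
      exact iInter₂_subset η h

theorem transIter_subset (hD : ∀ A, D A ⊆ A) (ζ : Ordinal) (A : Set Z) :
    transIter D ζ A ⊆ A := by
  simpa using transIter_antitone hD A (zero_le : 0 ≤ ζ)

theorem transIter_subset_preimage {D' : Set W → Set W} {φ : Z → W}
    (h : ∀ A B, A ⊆ φ ⁻¹' B → D A ⊆ φ ⁻¹' D' B) (ζ : Ordinal) {A : Set Z} {B : Set W}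
    (hAB : A ⊆ φ ⁻¹' B) : transIter D ζ A ⊆ φ ⁻¹' transIter D' ζ B := by
  induction ζ using Ordinal.limitRecOn with
  | zero => simpa using hAB
  | add_one ζ ih =>
    rw [transIter_add_one, transIter_add_one]
    exact h _ _ ih
  | limit ζ hζ ih =>
    rw [transIter_limit D hζ, transIter_limit D' hζ, preimage_iInter₂]
    exact iInter₂_mono ih

theorem transIter_mono {D' : Set Z → Set Z} (h : ∀ A B, A ⊆ B → D A ⊆ D' B) (ζ : Ordinal)
    {A B : Set Z} (hAB : A ⊆ B) : transIter D ζ A ⊆ transIter D' ζ B :=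
  transIter_subset_preimage (φ := id) h ζ hAB

theorem transIter_id (ζ : Ordinal) (A : Set Z) : transIter id ζ A = A := by
  refine (transIter_subset (fun _ => Subset.rfl) ζ A).antisymm ?_
  induction ζ using Ordinal.limitRecOn with
  | zero => simp
  | add_one ζ ih => simpa only [transIter_add_one] using ih
  | limit ζ hζ ih => simpa only [transIter_limit _ hζ] using subset_iInter₂ ih

theorem isClosed_transIter [TopologicalSpace Z] (hcl : ∀ A, IsClosed A → IsClosed (D A))
    (ζ : Ordinal) {A : Set Z} (hA : IsClosed A) : IsClosed (transIter D ζ A) := by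
  induction ζ using Ordinal.limitRecOn with
  | zero => simpa using hA
  | add_one ζ ih => simpa only [transIter_add_one] using hcl _ ih
  | limit ζ hζ ih =>
    rw [transIter_limit D hζ]
    exact isClosed_biInter ih

theorem transIter_union [TopologicalSpace Z] (hsub : ∀ A, D A ⊆ A)
    (hmono : ∀ A B, A ⊆ B → D A ⊆ D B) (hcl : ∀ A, IsClosed A → IsClosed (D A))
    (hun : ∀ A B, IsClosed A → IsClosed B → D (A ∪ B) ⊆ D A ∪ D B) (ζ : Ordinal)
    {A B : Set Z} (hA : IsClosed A) (hB : IsClosed B) :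
    transIter D ζ (A ∪ B) ⊆ transIter D ζ A ∪ transIter D ζ B := by
  induction ζ using Ordinal.limitRecOn with
  | zero => simp
  | add_one ζ ih =>
    simp only [transIter_add_one]
    exact (hmono _ _ ih).trans
      (hun _ _ (isClosed_transIter hcl ζ hA) (isClosed_transIter hcl ζ hB))
  | limit ζ hζ ih =>
    simp only [transIter_limit D hζ]
    intro x hx
    by_contra hxn
    simp only [mem_union, mem_iInter, not_or, not_forall] at hxn hx
    obtain ⟨⟨η₁, h₁, hx₁⟩, η₂, h₂, hx₂⟩ := hxn
    rcases ih _ (max_lt h₁ h₂) (hx _ (max_lt h₁ h₂)) with h | h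
    · exact hx₁ (transIter_antitone hsub A (le_max_left _ _) h)
    · exact hx₂ (transIter_antitone hsub B (le_max_right _ _) h)

theorem transIter_eq_iInter {ι : Type*} (hD : ∀ A, D A ⊆ A) {ζ : Ordinal}
    (hζ : Order.IsSuccLimit ζ) {f : ι → Ordinal} (hf : ∀ i, f i < ζ)
    (hcof : ∀ η < ζ, ∃ i, η ≤ f i) (A : Set Z) :
    transIter D ζ A = ⋂ i, transIter D (f i) A := by
  rw [transIter_limit D hζ]
  refine (subset_iInter fun i => iInter₂_subset (f i) (hf i)).antisymm
    (subset_iInter₂ fun η hη => ?_)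
  obtain ⟨i, hi⟩ := hcof η hη
  exact (iInter_subset _ i).trans (transIter_antitone hD A hi)

theorem transIter_add (hD : ∀ A, D A ⊆ A) (ζ η : Ordinal) (A : Set Z) :
    transIter D (ζ + η) A = transIter D η (transIter D ζ A) := by
  induction η using Ordinal.limitRecOn with
  | zero => simp
  | add_one η ih => rw [← add_assoc, transIter_add_one, transIter_add_one, ih]
  | limit η hη ih =>
    rw [transIter_limit D hη, transIter_eq_iInter hD (Ordinal.isSuccLimit_add ζ hη)
      (f := fun ν : Iio η => ζ + ν) (fun ν => (add_lt_add_iff_left ζ).2 ν.2), iInter_subtype]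
    · exact iInter₂_congr ih
    · intro μ hμ
      obtain ⟨ν, hν, h⟩ := (Ordinal.lt_add_iff_of_isSuccLimit hη).1 hμ
      exact ⟨⟨ν, hν⟩, h.le⟩

theorem transIter_opow_add_one (hD : ∀ A, D A ⊆ A) (ξ : Ordinal) (A : Set Z) :
    transIter D (ω ^ (ξ + 1)) A = ⋂ n : ℕ, transIter D (ω ^ ξ * n) A := by
  have hpos : (0 : Ordinal) < ω ^ ξ := Ordinal.opow_pos ξ Ordinal.omega0_pos
  rw [← Order.succ_eq_add_one, Ordinal.opow_succ]
  refine transIter_eq_iInter hD (Ordinal.isSuccLimit_mul_right hpos Ordinal.isSuccLimit_omega0)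
    (fun n => by gcongr; exact Ordinal.natCast_lt_omega0 n) (fun μ hμ => ?_) A
  obtain ⟨ν, hν, h⟩ := (Ordinal.lt_mul_iff_of_isSuccLimit Ordinal.isSuccLimit_omega0).1 hμ
  obtain ⟨n, rfl⟩ := Ordinal.lt_omega0.1 hν
  exact ⟨n, h.le⟩

theorem transIter_opow_limit (hD : ∀ A, D A ⊆ A) {ξ : Ordinal} (hξ : Order.IsSuccLimit ξ)
    (A : Set Z) : transIter D (ω ^ ξ) A = ⋂ η : Iio ξ, transIter D (ω ^ (η : Ordinal)) A := by
  refine transIter_eq_iInter hD (Ordinal.isSuccLimit_opow Ordinal.one_lt_omega0 hξ)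
    (fun η => (Ordinal.opow_lt_opow_iff_right Ordinal.one_lt_omega0).2 η.2) (fun μ hμ => ?_) A
  obtain ⟨ν, hν, h⟩ := (Ordinal.lt_opow_of_isSuccLimit Ordinal.omega0_ne_zero hξ).1 hμ
  exact ⟨⟨ν, hν⟩, h.le⟩

end Iteration

section ClosedDerivation

variable {Z : Type*} [TopologicalSpace Z] {d : Z → Z → ℝ}

/-- The closed derivation associated with `d`: for `ε > 0`, the closure in `A` of the set of
points `x` of `A` that are limits of points `y` of `A` such that `d x y > ε`. For `ε ≤ 0` it does
nothing to `A`, as in `iterDeriv`. Unlike `pointDeriv`, which compares two points close to `x`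
with each other, it is subadditive under unions of closed sets, without any loss on `ε`; the
closure makes up for `d` not being upper semicontinuous. -/
def clDeriv (d : Z → Z → ℝ) (ε : ℝ) (A : Set Z) : Set Z :=
  A ∩ closure {x ∈ A | ∃ᶠ y in 𝓝[A] x, 0 < ε → ε < d x y}

theorem clDeriv_subset (ε : ℝ) (A : Set Z) : clDeriv d ε A ⊆ A := inter_subset_left

theorem clDeriv_of_nonpos {ε : ℝ} (hε : ε ≤ 0) : clDeriv d ε = id := by
  funext A
  refine inter_eq_left.2 fun x hx => subset_closure ⟨hx, ?_⟩
  have := mem_closure_iff_nhdsWithin_neBot.1 (subset_closure hx)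
  exact Frequently.of_forall fun y h => absurd h hε.not_gt

theorem clDeriv_mono {ε ε' : ℝ} (hε : ε' ≤ ε) (A B : Set Z) (h : A ⊆ B) :
    clDeriv d ε A ⊆ clDeriv d ε' B :=
  inter_subset_inter h (closure_mono fun _ hx => ⟨h hx.1,
    (hx.2.filter_mono (nhdsWithin_mono _ h)).mono fun _ hy hε' =>
      hε.trans_lt (hy (hε'.trans_le hε))⟩)

theorem isClosed_clDeriv (ε : ℝ) (A : Set Z) (hA : IsClosed A) : IsClosed (clDeriv d ε A) :=
  hA.inter isClosed_closure

theorem clDeriv_eq_closure (ε : ℝ) {A : Set Z} (hA : IsClosed A) :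
    clDeriv d ε A = closure {x ∈ A | ∃ᶠ y in 𝓝[A] x, 0 < ε → ε < d x y} :=
  inter_eq_right.2 (closure_minimal (sep_subset _ _) hA)

theorem clDeriv_union (ε : ℝ) (A B : Set Z) (hA : IsClosed A) (hB : IsClosed B) :
    clDeriv d ε (A ∪ B) ⊆ clDeriv d ε A ∪ clDeriv d ε B := by
  rw [clDeriv_eq_closure ε hA, clDeriv_eq_closure ε hB, clDeriv_eq_closure ε (hA.union hB),
    ← closure_union]
  refine closure_mono fun x hx => ?_
  have hmem : ∀ {F : Set Z}, IsClosed F → (∃ᶠ y in 𝓝[F] x, 0 < ε → ε < d x y) → x ∈ F :=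
    fun hF h => hF.closure_subset (mem_closure_iff_nhdsWithin_neBot.2
      ((frequently_true_iff_neBot _).1 (h.mono fun _ _ => trivial)))
  rw [mem_ofPred_eq, nhdsWithin_union, frequently_sup] at hx
  exact hx.2.imp (fun h => ⟨hmem hA h, h⟩) fun h => ⟨hmem hB h, h⟩

/-- The transfinite iteration of `clDeriv`, the analogue of `iterDeriv`. -/
def clIterDeriv (d : Z → Z → ℝ) (ε : ℝ) (ζ : Ordinal) (A : Set Z) : Set Z :=
  transIter (clDeriv d ε) ζ A

theorem clIterDeriv_subset (ε : ℝ) (ζ : Ordinal) (A : Set Z) : clIterDeriv d ε ζ A ⊆ A :=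
  transIter_subset (clDeriv_subset ε) _ A

theorem clIterDeriv_of_nonpos {ε : ℝ} (hε : ε ≤ 0) (ζ : Ordinal) (A : Set Z) :
    clIterDeriv d ε ζ A = A := by
  rw [clIterDeriv, clDeriv_of_nonpos hε, transIter_id]

theorem clIterDeriv_mono {ε ε' : ℝ} (hε : ε' ≤ ε) (ζ : Ordinal) {A B : Set Z} (h : A ⊆ B) :
    clIterDeriv d ε ζ A ⊆ clIterDeriv d ε' ζ B :=
  transIter_mono (clDeriv_mono hε) _ h

theorem clIterDeriv_antitone (ε : ℝ) (A : Set Z) : Antitone fun ζ => clIterDeriv d ε ζ A :=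
  transIter_antitone (clDeriv_subset ε) A

theorem isClosed_clIterDeriv (ε : ℝ) (ζ : Ordinal) {A : Set Z} (hA : IsClosed A) :
    IsClosed (clIterDeriv d ε ζ A) :=
  isClosed_transIter (isClosed_clDeriv ε) _ hA

theorem clIterDeriv_union (ε : ℝ) (ζ : Ordinal) {A B : Set Z} (hA : IsClosed A)
    (hB : IsClosed B) :
    clIterDeriv d ε ζ (A ∪ B) ⊆ clIterDeriv d ε ζ A ∪ clIterDeriv d ε ζ B :=
  transIter_union (clDeriv_subset ε) (clDeriv_mono le_rfl) (isClosed_clDeriv ε)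
    (clDeriv_union ε) _ hA hB

theorem clIterDeriv_add (ε : ℝ) (ζ η : Ordinal) (A : Set Z) :
    clIterDeriv d ε (ζ + η) A = clIterDeriv d ε η (clIterDeriv d ε ζ A) :=
  transIter_add (clDeriv_subset ε) ζ η A

theorem clIterDeriv_opow_zero (ε : ℝ) (A : Set Z) :
    clIterDeriv d ε (ω ^ (0 : Ordinal)) A = clDeriv d ε A := by
  rw [clIterDeriv, Ordinal.opow_zero, transIter_one]

theorem clIterDeriv_opow_add_one (ε : ℝ) (ξ : Ordinal) (A : Set Z) :
    clIterDeriv d ε (ω ^ (ξ + 1)) A = ⋂ n : ℕ, clIterDeriv d ε (ω ^ ξ * n) A :=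
  transIter_opow_add_one (clDeriv_subset ε) ξ A

theorem clIterDeriv_opow_limit (ε : ℝ) {ξ : Ordinal} (hξ : Order.IsSuccLimit ξ) (A : Set Z) :
    clIterDeriv d ε (ω ^ ξ) A = ⋂ η : Iio ξ, clIterDeriv d ε (ω ^ (η : Ordinal)) A :=
  transIter_opow_limit (clDeriv_subset ε) hξ A

/-- The successive derivations `clIterDeriv d ε (ω ^ ξ)` for `ε` in a list, the head of the list
being applied last: the analogue of `multiDeriv`. -/
def clMultiDeriv (d : Z → Z → ℝ) (ξ : Ordinal) (l : List ℝ) (A : Set Z) : Set Z :=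
  l.foldr (fun ε L => clIterDeriv d ε (ω ^ ξ) L) A

@[simp]
theorem clMultiDeriv_nil (ξ : Ordinal) (A : Set Z) : clMultiDeriv d ξ [] A = A := rfl

theorem clMultiDeriv_cons (ξ : Ordinal) (ε : ℝ) (l : List ℝ) (A : Set Z) :
    clMultiDeriv d ξ (ε :: l) A = clIterDeriv d ε (ω ^ ξ) (clMultiDeriv d ξ l A) := rfl

theorem clMultiDeriv_concat (ξ : Ordinal) (l : List ℝ) (ε : ℝ) (A : Set Z) :
    clMultiDeriv d ξ (l ++ [ε]) A = clMultiDeriv d ξ l (clIterDeriv d ε (ω ^ ξ) A) := by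
  simp [clMultiDeriv]

theorem clMultiDeriv_mono (ξ : Ordinal) (l : List ℝ) {A B : Set Z} (h : A ⊆ B) :
    clMultiDeriv d ξ l A ⊆ clMultiDeriv d ξ l B := by
  induction l with
  | nil => exact h
  | cons ε l ih => exact clIterDeriv_mono le_rfl _ ih

theorem isClosed_clMultiDeriv (ξ : Ordinal) (l : List ℝ) {A : Set Z} (hA : IsClosed A) :
    IsClosed (clMultiDeriv d ξ l A) := by
  induction l with
  | nil => exact hA
  | cons ε l ih => exact isClosed_clIterDeriv ε _ ih

theorem clMultiDeriv_union (ξ : Ordinal) (l : List ℝ) {A B : Set Z} (hA : IsClosed A)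
    (hB : IsClosed B) :
    clMultiDeriv d ξ l (A ∪ B) ⊆ clMultiDeriv d ξ l A ∪ clMultiDeriv d ξ l B := by
  induction l with
  | nil => rfl
  | cons ε l ih =>
    exact (clIterDeriv_mono le_rfl _ ih).trans
      (clIterDeriv_union ε _ (isClosed_clMultiDeriv ξ l hA) (isClosed_clMultiDeriv ξ l hB))

end ClosedDerivation

section Product

variable {Z₀ Z₁ : Type*} [TopologicalSpace Z₀] [TopologicalSpace Z₁]

/-- The maximum of `d₀` and `d₁` on a product, the distance for which the derivations of a
rectangle split into derivations of its sides. -/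
def maxDist (d₀ : Z₀ → Z₀ → ℝ) (d₁ : Z₁ → Z₁ → ℝ) (p q : Z₀ × Z₁) : ℝ :=
  max (d₀ p.1 q.1) (d₁ p.2 q.2)

variable {d₀ : Z₀ → Z₀ → ℝ} {d₁ : Z₁ → Z₁ → ℝ}

theorem clDeriv_prod (ε : ℝ) (A : Set Z₀) (B : Set Z₁) :
    clDeriv (maxDist d₀ d₁) ε (A ×ˢ B) ⊆ clDeriv d₀ ε A ×ˢ B ∪ A ×ˢ clDeriv d₁ ε B := by
  have hsplit : {p ∈ A ×ˢ B | ∃ᶠ q in 𝓝[A ×ˢ B] p, 0 < ε → ε < maxDist d₀ d₁ p q} ⊆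
      {x ∈ A | ∃ᶠ y in 𝓝[A] x, 0 < ε → ε < d₀ x y} ×ˢ univ ∪
        univ ×ˢ {x ∈ B | ∃ᶠ y in 𝓝[B] x, 0 < ε → ε < d₁ x y} := by
    rintro ⟨x₀, x₁⟩ ⟨hxAB, hx⟩
    simp only [nhdsWithin_prod_eq, maxDist, lt_max_iff, imp_or,
      frequently_or_distrib] at hx
    exact hx.imp (fun h => ⟨⟨hxAB.1, tendsto_fst.frequently h⟩, trivial⟩)
      (fun h => ⟨trivial, hxAB.2, tendsto_snd.frequently h⟩)
  rintro p ⟨hp, hcl⟩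
  replace hcl := closure_mono hsplit hcl
  rw [closure_union, closure_prod_eq, closure_prod_eq] at hcl
  exact hcl.imp (fun h => ⟨⟨hp.1, h.1⟩, hp.2⟩) (fun h => ⟨hp.1, hp.2, h.2⟩)

theorem exists_mem_of_mem_clIterDeriv_mul_prod {ε : ℝ} {ζ : Ordinal}
    (h : ∀ {A : Set Z₀} {B : Set Z₁}, IsClosed A → IsClosed B →
      clIterDeriv (maxDist d₀ d₁) ε ζ (A ×ˢ B) ⊆
        clIterDeriv d₀ ε ζ A ×ˢ B ∪ A ×ˢ clIterDeriv d₁ ε ζ B)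
    (n : ℕ) {A : Set Z₀} {B : Set Z₁} (hA : IsClosed A) (hB : IsClosed B) {p : Z₀ × Z₁}
    (hp : p ∈ clIterDeriv (maxDist d₀ d₁) ε (ζ * n) (A ×ˢ B)) :
    ∃ i j : ℕ, i + j = n ∧ p.1 ∈ clIterDeriv d₀ ε (ζ * i) A ∧
      p.2 ∈ clIterDeriv d₁ ε (ζ * j) B := by
  induction n generalizing A B with
  | zero => exact ⟨0, 0, rfl, by simpa [clIterDeriv] using hp⟩
  | succ n ih =>
    have hsucc : ∀ m : ℕ, ζ * (m + 1 : ℕ) = ζ + ζ * m := fun m => by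
      rw [Nat.add_comm, Nat.cast_add, Nat.cast_one, mul_add, mul_one]
    have hA' : IsClosed (clIterDeriv d₀ ε ζ A) := isClosed_clIterDeriv ε ζ hA
    have hB' : IsClosed (clIterDeriv d₁ ε ζ B) := isClosed_clIterDeriv ε ζ hB
    rw [hsucc, clIterDeriv_add] at hp
    rcases clIterDeriv_union ε _ (hA'.prod hB) (hA.prod hB')
      (clIterDeriv_mono le_rfl _ (h hA hB) hp) with hp | hp
    · obtain ⟨i, j, hij, hi, hj⟩ := ih hA' hB hp
      exact ⟨i + 1, j, by omega, by rwa [hsucc, clIterDeriv_add], hj⟩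
    · obtain ⟨i, j, hij, hi, hj⟩ := ih hA hB' hp
      exact ⟨i, j + 1, by omega, hi, by rwa [hsucc, clIterDeriv_add]⟩

theorem clIterDeriv_opow_prod (ε : ℝ) (ξ : Ordinal) {A : Set Z₀} {B : Set Z₁}
    (hA : IsClosed A) (hB : IsClosed B) :
    clIterDeriv (maxDist d₀ d₁) ε (ω ^ ξ) (A ×ˢ B) ⊆
      clIterDeriv d₀ ε (ω ^ ξ) A ×ˢ B ∪ A ×ˢ clIterDeriv d₁ ε (ω ^ ξ) B := by
  induction ξ using Ordinal.limitRecOn generalizing A B with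
  | zero =>
    simp only [clIterDeriv_opow_zero]
    exact clDeriv_prod ε A B
  | add_one ξ ih =>
    intro p hp
    obtain ⟨hpA, hpB⟩ := clIterDeriv_subset _ _ _ hp
    simp only [clIterDeriv_opow_add_one, mem_iInter] at hp ⊢
    by_contra hnot
    simp only [mem_union, mem_prod, mem_iInter, hpA, hpB, true_and, and_true, not_or,
      not_forall] at hnot
    obtain ⟨⟨i, hi⟩, j, hj⟩ := hnot
    obtain ⟨i', j', hij, hi', hj'⟩ :=
      exists_mem_of_mem_clIterDeriv_mul_prod ih (i + j) hA hB (hp (i + j))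
    rcases le_total i i' with h | h
    · exact hi (clIterDeriv_antitone ε A (by gcongr) hi')
    · have h' : j ≤ j' := by omega
      exact hj (clIterDeriv_antitone ε B (by gcongr) hj')
  | limit ξ hξ ih =>
    intro p hp
    obtain ⟨hpA, hpB⟩ := clIterDeriv_subset _ _ _ hp
    simp only [clIterDeriv_opow_limit ε hξ, mem_iInter] at hp ⊢
    by_contra hnot
    simp only [mem_union, mem_prod, mem_iInter, hpA, hpB, true_and, and_true, not_or,
      not_forall] at hnot
    obtain ⟨⟨η₁, h₁⟩, η₂, h₂⟩ := hnot
    have hanti : ∀ {η η' : Ordinal}, η ≤ η' → (ω : Ordinal) ^ η ≤ ω ^ η' :=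
      fun h => Ordinal.opow_le_opow_right Ordinal.omega0_pos h
    have hmax : max (η₁ : Ordinal) η₂ < ξ := max_lt η₁.2 η₂.2
    rcases ih _ hmax hA hB (hp ⟨_, hmax⟩) with h | h
    · exact h₁ (clIterDeriv_antitone ε A (hanti (le_max_left _ _)) h.1)
    · exact h₂ (clIterDeriv_antitone ε B (hanti (le_max_right _ _)) h.2)

theorem exists_perm_of_mem_clMultiDeriv_prod (ξ : Ordinal) (l : List ℝ) {A : Set Z₀}
    {B : Set Z₁} (hA : IsClosed A) (hB : IsClosed B) {p : Z₀ × Z₁}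
    (hp : p ∈ clMultiDeriv (maxDist d₀ d₁) ξ l (A ×ˢ B)) :
    ∃ l₀ l₁ : List ℝ, l.Perm (l₀ ++ l₁) ∧ p.1 ∈ clMultiDeriv d₀ ξ l₀ A ∧
      p.2 ∈ clMultiDeriv d₁ ξ l₁ B := by
  induction l using List.reverseRecOn generalizing A B with
  | nil => exact ⟨[], [], .nil, hp.1, hp.2⟩
  | append_singleton l ε ih =>
    have hA' : IsClosed (clIterDeriv d₀ ε (ω ^ ξ) A) := isClosed_clIterDeriv ε _ hA
    have hB' : IsClosed (clIterDeriv d₁ ε (ω ^ ξ) B) := isClosed_clIterDeriv ε _ hB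
    rw [clMultiDeriv_concat] at hp
    rcases clMultiDeriv_union ξ l (hA'.prod hB) (hA.prod hB')
      (clMultiDeriv_mono ξ l (clIterDeriv_opow_prod ε ξ hA hB) hp) with hp | hp
    · obtain ⟨l₀, l₁, hl, hp₀, hp₁⟩ := ih hA' hB hp
      refine ⟨l₀ ++ [ε], l₁, (hl.append_right [ε]).trans ?_, by rwa [clMultiDeriv_concat], hp₁⟩
      simpa only [List.append_assoc] using List.perm_append_comm.append_left l₀
    · obtain ⟨l₀, l₁, hl, hp₀, hp₁⟩ := ih hA hB' hp
      exact ⟨l₀, l₁ ++ [ε], by simpa using hl.append_right [ε], hp₀, by rwa [clMultiDeriv_concat]⟩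

end Product

section AlmostNull

variable {𝕜 E : Type*} [RCLike 𝕜] [NormedAddCommGroup E] [NormedSpace 𝕜 E]

theorem exists_norm_le_one_lt_re {f : StrongDual 𝕜 E} {ε : ℝ} (h : ε < ‖f‖) :
    ∃ v : E, ‖v‖ ≤ 1 ∧ ε < re (f v) := by
  obtain ⟨v, hv, hlt⟩ := f.exists_lt_apply_of_lt_opNorm h
  obtain ⟨c, hc, hcv⟩ := exists_norm_eq_mul_self (f v)
  refine ⟨c • v, by rw [norm_smul, hc, one_mul]; exact hv.le, ?_⟩
  rwa [map_smul, smul_eq_mul, ← hcv, ofReal_re]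

theorem frequently_lt_dist_of_mem_pointDeriv {ε : ℝ} {H : Set (WeakDual 𝕜 E)}
    {x : WeakDual 𝕜 E} (hx : x ∈ pointDeriv ε H) :
    ∃ᶠ y in 𝓝[H] x,
      ε / 2 < dist (WeakDual.toStrongDual x) (WeakDual.toStrongDual y) := by
  refine frequently_nhdsWithin_iff.2 (frequently_iff.2 fun {V} hV => ?_)
  by_contra! hle
  refine (hx.2 V hV).not_ge (Metric.ediam_le ?_)
  rintro _ ⟨y, ⟨hyV, hyH⟩, rfl⟩ _ ⟨z, ⟨hzV, hzH⟩, rfl⟩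
  have hy := not_imp_not.2 (hle y hyV) (not_not.2 hyH)
  have hz := not_imp_not.2 (hle z hzV) (not_not.2 hzH)
  rw [edist_dist]
  refine ENNReal.ofReal_le_ofReal ((dist_triangle_left _ _ (WeakDual.toStrongDual x)).trans ?_)
  linarith

/-- The difference of two vectors at which `y - x` and `y' - x` are large, for `y` close to `x`
after `y'` has been chosen, is small for `φ` if both have almost the same image under `φ`. -/
theorem frequently_exists_norm_le_re_sub {F : Type*} [NormedAddCommGroup F] [NormedSpace 𝕜 F]
    [ProperSpace F] {H : Set (WeakDual 𝕜 E)} {x : WeakDual 𝕜 E} {ε : ℝ}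
    (hx : ∃ᶠ y in 𝓝[H] x, ε < dist (WeakDual.toStrongDual x) (WeakDual.toStrongDual y))
    (φ : E →L[𝕜] F) {η : ℝ} (hη : 0 < η) :
    ∃ᶠ y in 𝓝[H] x, ∃ v : E, ‖v‖ ≤ 1 ∧ ‖φ v‖ ≤ η ∧ ε / 2 - η ≤ re (y v - x v) := by
  have hnorming : ∀ y : WeakDual 𝕜 E, ∃ v : E, ‖v‖ ≤ 1 ∧
      (ε < dist (WeakDual.toStrongDual x) (WeakDual.toStrongDual y) →
        ε < re (y v - x v)) := by
    intro y
    by_cases h : ε < dist (WeakDual.toStrongDual x) (WeakDual.toStrongDual y)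
    · rw [dist_comm, dist_eq_norm] at h
      obtain ⟨v, hv, hε⟩ := exists_norm_le_one_lt_re h
      exact ⟨v, hv, fun _ => hε⟩
    · exact ⟨0, by simp, fun h' => absurd h' h⟩
  choose v hv hvε using hnorming
  set l := 𝓝[H] x ⊓ 𝓟 {y | ε < dist (WeakDual.toStrongDual x) (WeakDual.toStrongDual y)}
  have hl : l.NeBot := frequently_mem_iff_neBot.1 hx
  obtain ⟨p, -, hp⟩ := (isCompact_closedBall (0 : F) ‖φ‖).exists_mapClusterPt
    (f := l) (u := fun y => φ (v y)) <| tendsto_principal.2 <| Eventually.of_forall fun y => by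
      simpa using φ.le_of_opNorm_le_of_le le_rfl (hv y)
  have hclose : ∃ᶠ y in l, φ (v y) ∈ Metric.ball p η := hp.frequently (Metric.ball_mem_nhds p hη)
  obtain ⟨y', hy'⟩ := hclose.exists
  have hsmall : ∀ᶠ y in l, re (y (v y') - x (v y')) < η := by
    have hc : Continuous fun y : WeakDual 𝕜 E => re (y (v y') - x (v y')) :=
      continuous_re.comp ((WeakDual.eval_continuous _).sub continuous_const)
    exact (hc.continuousAt.eventually_lt continuousAt_const (by simpa using hη)).filter_mono
      (inf_le_left.trans nhdsWithin_le_nhds)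
  have hfar : ∀ᶠ y in l, ε < re (y (v y) - x (v y)) :=
    mem_inf_of_right fun y hy => hvε y hy
  refine ((hclose.and_eventually (hsmall.and hfar)).filter_mono inf_le_left).mono ?_
  rintro y ⟨hy, hyx, hyε⟩
  have hhalf : (2⁻¹ : 𝕜) = (2⁻¹ : ℝ) := by rw [ofReal_inv, ofReal_ofNat]
  refine ⟨(2⁻¹ : 𝕜) • (v y - v y'), ?_, ?_, ?_⟩
  · have := norm_sub_le_of_le (hv y) (hv y')
    rw [norm_smul, norm_inv, norm_ofNat]
    linarith
  · have := dist_triangle_right (φ (v y)) (φ (v y')) p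
    rw [dist_eq_norm] at this
    rw [map_smul, map_sub, norm_smul, norm_inv, norm_ofNat]
    linarith [Metric.mem_ball.1 hy, Metric.mem_ball.1 hy']
  · rw [map_smul, map_smul, ← smul_sub, map_sub, map_sub, hhalf, smul_eq_mul, re_ofReal_mul,
      sub_sub_sub_comm, map_sub]
    linarith

end AlmostNull

section Envelope

variable {T : Type*}

/-- A set `S` of pairs `(A, w)` stands for the step function on `T` whose value at `t` is the
largest `w` with `t ∈ A` for some `(A, w) ∈ S`; this says that `g` is at least that function. -/
def IsMajorant (g : T → ℝ) (S : Set (Set T × ℝ)) : Prop :=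
  ∀ p ∈ S, ∀ t ∈ p.1, p.2 ≤ g t

/-- The step function of `S` has finitely many steps and is upper semicontinuous. -/
def IsClosedStep [TopologicalSpace T] (S : Set (Set T × ℝ)) : Prop :=
  S.Finite ∧ ∀ p ∈ S, IsClosed p.1

/-- The step function that gains `a * (j * δ)` on the derived set of level `j * δ` of each of the
sets of `S`, where `j` runs through `0, …, J`. -/
def shift [TopologicalSpace T] (d : T → T → ℝ) (ξ : Ordinal) (a δ : ℝ) (J : ℕ)
    (S : Set (Set T × ℝ)) : Set (Set T × ℝ) :=
  image2 (fun p (j : ℕ) => (clIterDeriv d (j * δ) (ω ^ ξ) p.1, p.2 + a * (j * δ))) S (Iic J)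

theorem IsClosedStep.shift [TopologicalSpace T] {S : Set (Set T × ℝ)} (hS : IsClosedStep S)
    (d : T → T → ℝ) (ξ : Ordinal) (a δ : ℝ) (J : ℕ) : IsClosedStep (shift d ξ a δ J S) := by
  refine ⟨hS.1.image2 _ (finite_Iic J), ?_⟩
  rintro _ ⟨p, hp, j, -, rfl⟩
  exact isClosed_clIterDeriv _ _ (hS.2 p hp)

theorem isMajorant_shift_iff [TopologicalSpace T] {d : T → T → ℝ} {ξ : Ordinal} {a δ : ℝ} {J : ℕ}
    {S : Set (Set T × ℝ)} {g : T → ℝ} : IsMajorant g (shift d ξ a δ J S) ↔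
      ∀ p ∈ S, ∀ j ≤ J, ∀ t ∈ clIterDeriv d (j * δ) (ω ^ ξ) p.1, p.2 + a * (j * δ) ≤ g t :=
  forall_mem_image2

variable {𝕜 E : Type*} [RCLike 𝕜] [NormedAddCommGroup E] [NormedSpace 𝕜 E]

/-- The functionals at which the upper envelope of the step function of `S`, carried over to the
dual space by `Φ`, is at least `r`; the upper envelope is the infimum of the affine functions
`x ↦ re (x u) + c` that majorize the step function. -/
def envelope (Φ : T → StrongDual 𝕜 E) (S : Set (Set T × ℝ)) (r : ℝ) : Set (WeakDual 𝕜 E) :=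
  {x | ∀ (u : E) (c : ℝ), IsMajorant (fun t => re (Φ t u) + c) S → r ≤ re (x u) + c}

variable {Φ : T → StrongDual 𝕜 E} {S : Set (Set T × ℝ)}

theorem envelope_anti {r r' : ℝ} (h : r' ≤ r) : envelope Φ S r ⊆ envelope Φ S r' :=
  fun _ hx u c hc => h.trans (hx u c hc)

theorem isMajorant_sub_smul {d : T → T → ℝ} (hd : ∀ s t, dist (Φ s) (Φ t) ≤ d s t)
    {a : ℝ} (ha : 0 ≤ a) {F : Finset T} {u : E} {c : ℝ}
    (hF : ∀ s, ∃ t ∈ F, ∀ p ∈ S, s ∈ p.1 → p.2 + a * d t s ≤ re (Φ s u) + c) {v : E}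
    (hv : ‖v‖ ≤ 1) {η : ℝ} (hφv : ∀ t ∈ F, ‖Φ t v‖ ≤ η) :
    IsMajorant (fun s => re (Φ s (u - (a : 𝕜) • v)) + (c + a * η)) S := by
  intro p hp s hs
  obtain ⟨t, htF, ht⟩ := hF s
  have hst : re (Φ s v - Φ t v) ≤ d t s := by
    refine (re_le_norm _).trans (le_trans ?_ (hd t s))
    rw [dist_comm, dist_eq_norm]
    exact (Φ s - Φ t).unit_le_opNorm v hv
  have htv : re (Φ t v) ≤ η := (re_le_norm _).trans (hφv t htF)
  have hsv : a * re (Φ s v) ≤ a * (d t s + η) := by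
    rw [map_sub] at hst
    gcongr
    linarith
  simp only [map_sub, map_smul, smul_eq_mul, re_ofReal_mul]
  linarith [ht p hp hs]

variable [TopologicalSpace T] {d : T → T → ℝ}

theorem envelope_subset_envelope_shift (ξ : Ordinal) (a δ : ℝ) (J : ℕ) (r : ℝ) :
    envelope Φ S r ⊆ envelope Φ (shift d ξ a δ J S) r := by
  refine fun x hx u c hc => hx u c fun p hp t ht => ?_
  have := isMajorant_shift_iff.1 hc p hp 0 (Nat.zero_le J) t
  simp only [Nat.cast_zero, zero_mul, mul_zero, add_zero, clIterDeriv_of_nonpos le_rfl] at this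
  exact this ht

theorem exists_mem_clDeriv_eventually_le {δ : ℝ} (hδ : 0 ≤ δ) {J : ℕ} {A : Set T} {t : T}
    (ht : t ∈ A) (hR : ∀ s, d t s ≤ J * δ) :
    ∃ j ≤ J, t ∈ clDeriv d (j * δ) A ∧ ∀ᶠ s in 𝓝[A] t, d t s ≤ j * δ + δ := by
  classical
  set j := Nat.findGreatest (fun j : ℕ => t ∈ clDeriv d (j * δ) A) J
  have hjt : t ∈ clDeriv d (j * δ) A :=
    Nat.findGreatest_spec (P := fun j : ℕ => t ∈ clDeriv d (j * δ) A) (Nat.zero_le J)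
      (by simpa [clDeriv_of_nonpos] using ht)
  have hjJ : j ≤ J := Nat.findGreatest_le J
  refine ⟨j, hjJ, hjt, ?_⟩
  rcases hjJ.eq_or_lt with hJ | hJ
  · exact Eventually.of_forall fun s => (hR s).trans (by rw [hJ]; linarith)
  · have hnot := Nat.findGreatest_is_greatest
      (P := fun j : ℕ => t ∈ clDeriv d (j * δ) A) (Nat.lt_succ_self j) (Nat.succ_le_of_lt hJ)
    refine not_frequently.1 (fun h => hnot ⟨ht, subset_closure ⟨ht, h⟩⟩) |>.mono fun s hs => ?_
    push Not at hs
    simpa [add_mul] using hs.2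

theorem IsMajorant.eventually_add_le {a δ : ℝ} {J : ℕ} (ha : 0 ≤ a) (hδ : 0 ≤ δ)
    (hR : ∀ s t, d s t ≤ J * δ) (hS : IsClosedStep S) {g : T → ℝ} (hg : Continuous g)
    (h : IsMajorant g (shift d 0 a δ J S)) {η : ℝ} (hη : 0 < η) (t : T) :
    ∀ᶠ s in 𝓝 t, ∀ p ∈ S, s ∈ p.1 → p.2 + a * d t s ≤ g s + a * δ + η := by
  refine (eventually_all_finite hS.1).2 fun p hp => ?_
  by_cases ht : t ∈ p.1
  · obtain ⟨j, hj, htj, hev⟩ := exists_mem_clDeriv_eventually_le hδ ht (hR t)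
    have hgt : p.2 + a * (j * δ) ≤ g t :=
      isMajorant_shift_iff.1 h p hp j hj t (by rwa [clIterDeriv_opow_zero])
    filter_upwards [eventually_nhdsWithin_iff.1 hev,
      continuousAt_const.eventually_lt hg.continuousAt (sub_lt_self (g t) hη)] with s hs hgs hsp
    linarith [mul_le_mul_of_nonneg_left (hs hsp) ha]
  · filter_upwards [(hS.2 p hp).isOpen_compl.mem_nhds ht] with s hs hsp
    exact absurd hsp hs

variable [CompactSpace T]

theorem exists_finset_add_le {a δ : ℝ} {J : ℕ} (ha : 0 ≤ a) (hδ : 0 ≤ δ)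
    (hR : ∀ s t, d s t ≤ J * δ) (hS : IsClosedStep S) {g : T → ℝ} (hg : Continuous g)
    (h : IsMajorant g (shift d 0 a δ J S)) {η : ℝ} (hη : 0 < η) :
    ∃ F : Finset T, ∀ s, ∃ t ∈ F, ∀ p ∈ S, s ∈ p.1 → p.2 + a * d t s ≤ g s + a * δ + η := by
  obtain ⟨F, -, hF⟩ := isCompact_univ.elim_nhds_subcover _
    fun t _ => h.eventually_add_le ha hδ hR hS hg hη t
  exact ⟨F, fun s => by simpa using hF (mem_univ s)⟩

/-- If an affine function `g = re (· u) + c` majorizes the shifted step function, then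
`re (· (u - a • v)) + c` almost majorizes the step function itself as soon as `v` is in the unit
ball and almost annihilates finitely many `Φ t`; on the other hand it is smaller than `g` by
`a * ε / 4` at points close to a point of the derived set, for a suitable such `v`. -/
theorem pointDeriv_envelope_subset (hΦ : ∀ u, Continuous fun t => Φ t u)
    (hd : ∀ s t, dist (Φ s) (Φ t) ≤ d s t) {a δ : ℝ} {J : ℕ} (ha : 0 ≤ a) (hδ : 0 ≤ δ)
    (hR : ∀ s t, d s t ≤ J * δ) (hS : IsClosedStep S) (ε r : ℝ) :
    pointDeriv ε (envelope Φ S r) ⊆ envelope Φ (shift d 0 a δ J S) (r + a * (ε / 4 - δ)) := by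
  intro x hx u c hc
  have happrox : ∀ η : ℝ, 0 < η →
      r + a * (ε / 4 - δ) ≤ re (x u) + c + η * (2 + 3 * a) := by
    intro η hη
    obtain ⟨F, hF⟩ := exists_finset_add_le (g := fun t => re (Φ t u) + c) ha hδ hR hS
      ((continuous_re.comp (hΦ u)).add continuous_const) hc hη
    have hnear : ∀ᶠ y in 𝓝[envelope Φ S r] x, re (y u) < re (x u) + η :=
      ((continuous_re.comp (WeakDual.eval_continuous u)).continuousAt.eventually_lt
        continuousAt_const (lt_add_of_pos_right _ hη)).filter_mono nhdsWithin_le_nhds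
    obtain ⟨y, ⟨v, hv, hφv, hyv⟩, hyu, hy⟩ := ((frequently_exists_norm_le_re_sub
      (frequently_lt_dist_of_mem_pointDeriv hx) ((WeakDual.toStrongDual x).prod
        (ContinuousLinearMap.pi fun t : F => Φ t)) hη).and_eventually
          (hnear.and eventually_mem_nhdsWithin)).exists
    rw [ContinuousLinearMap.prod_apply, norm_prod_le_iff, pi_norm_le_iff_of_nonneg hη.le] at hφv
    have key := hy _ _ <| isMajorant_sub_smul hd ha (c := c + (a * δ + η))
      (fun s => (hF s).imp fun t ht => ht.imp_right fun h p hp hs =>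
        (h p hp hs).trans_eq (by ring)) hv fun t ht => hφv.2 ⟨t, ht⟩
    have hxv : -η ≤ re (x v) := (abs_le.1 ((abs_re_le_norm _).trans hφv.1)).1
    rw [map_sub, map_smul, smul_eq_mul, map_sub, re_ofReal_mul] at key
    rw [map_sub] at hyv
    have hav : a * (ε / 4 - 2 * η) ≤ a * re (y v) := by gcongr; linarith
    linarith
  refine le_of_forall_pos_le_add fun η hη => ?_
  have h := happrox (η / (2 + 3 * a)) (by positivity)
  rwa [div_mul_cancel₀ _ (by positivity)] at h

end Envelope

section Averaging

theorem sum_le_countP_mul_add_length_mul {J j : ℕ} {l : List ℕ} (hl : ∀ i ∈ l, i ≤ J) :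
    l.sum ≤ l.countP (fun i => j + 1 ≤ i) * J + l.length * j := by
  induction l with
  | nil => simp
  | cons i l ih =>
    have hi : i ≤ (if j + 1 ≤ i then J else 0) + j := by
      split_ifs
      · exact (hl i List.mem_cons_self).trans (Nat.le_add_right _ _)
      · omega
    have := ih fun i hi => hl i (List.mem_cons_of_mem _ hi)
    simp only [List.sum_cons, List.countP_cons, List.length_cons, decide_eq_true_eq, add_mul,
      ite_mul, one_mul, zero_mul]
    omega

theorem exists_le_countP_and_sum_le {J N : ℕ} {l : List ℕ} (hl : ∀ i ∈ l, i ≤ J)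
    (hN : N ≤ l.length) :
    ∃ j ≤ J, N ≤ l.countP (fun i => j ≤ i) ∧ l.sum ≤ l.length * j + N * J := by
  set j := Nat.findGreatest (fun j => N ≤ l.countP (fun i => j ≤ i)) J
  have hjJ : j ≤ J := Nat.findGreatest_le J
  refine ⟨j, hjJ, Nat.findGreatest_spec (P := fun j => N ≤ l.countP (fun i => j ≤ i))
    (Nat.zero_le J) (by simpa using hN), ?_⟩
  rcases hjJ.eq_or_lt with h | h
  · rw [h]
    exact (List.sum_le_card_nsmul l J hl).trans (Nat.le_add_right _ _)
  · have hlt := not_le.1 (Nat.findGreatest_is_greatest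
      (P := fun j => N ≤ l.countP (fun i => j ≤ i)) (Nat.lt_succ_self j) h)
    calc l.sum ≤ l.countP (fun i => j + 1 ≤ i) * J + l.length * j :=
          sum_le_countP_mul_add_length_mul hl
      _ ≤ N * J + l.length * j := by gcongr
      _ = l.length * j + N * J := add_comm _ _

variable {T : Type*} [TopologicalSpace T] {d : T → T → ℝ} {S : Set (Set T × ℝ)}

theorem clMultiDeriv_map_mul_subset (ξ : Ordinal) {δ : ℝ} (hδ : 0 ≤ δ) (j : ℕ) (l : List ℕ)
    (A : Set T) : clMultiDeriv d ξ (l.map fun i : ℕ => i * δ) A ⊆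
      clIterDeriv d (j * δ) (ω ^ ξ * l.countP (fun i => j ≤ i)) A := by
  induction l with
  | nil => simp [clIterDeriv]
  | cons i l ih =>
    rw [List.map_cons, clMultiDeriv_cons]
    by_cases h : j ≤ i
    · rw [List.countP_cons_of_pos (by simpa using h), Nat.cast_add_one, mul_add_one,
        clIterDeriv_add]
      exact clIterDeriv_mono (by gcongr) _ ih
    · rw [List.countP_cons_of_neg (by simpa using h)]
      exact (clIterDeriv_subset _ _ _).trans ih

theorem exists_of_mem_iterate_shift {ξ : Ordinal} {a δ : ℝ} {J n : ℕ} {q : Set T × ℝ}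
    (hq : q ∈ (shift d ξ a δ J)^[n] S) :
    ∃ p ∈ S, ∃ l : List ℕ, l.length = n ∧ (∀ j ∈ l, j ≤ J) ∧
      q = (clMultiDeriv d ξ (l.map fun j : ℕ => j * δ) p.1, p.2 + a * (l.sum * δ)) := by
  induction n generalizing q with
  | zero => exact ⟨q, hq, [], by simp⟩
  | succ n ih =>
    rw [Function.iterate_succ_apply'] at hq
    obtain ⟨q', hq', j, hj, rfl⟩ := hq
    obtain ⟨p, hp, l, hlen, hl, rfl⟩ := ih hq'
    refine ⟨p, hp, j :: l, by simp [hlen], List.forall_mem_cons.2 ⟨hj, hl⟩, ?_⟩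
    rw [List.map_cons, clMultiDeriv_cons, List.sum_cons, Nat.cast_add]
    ring_nf

theorem eventually_forall_le_add [CompactSpace T] {ι : Type*} [Nonempty ι] [LinearOrder ι]
    {F : ι → Set T} (hF : ∀ i, IsClosed (F i)) (hanti : Antitone F) {g : T → ℝ}
    (hg : Continuous g) {w : ℝ} (hw : ∀ t ∈ ⋂ i, F i, w ≤ g t) {η : ℝ} (hη : 0 < η) :
    ∀ᶠ i in atTop, ∀ t ∈ F i, w ≤ g t + η := by
  have hK : IsCompact {t | g t + η ≤ w} :=
    (isClosed_le (hg.add continuous_const) continuous_const).isCompact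
  obtain ⟨i, hi⟩ := hK.elim_directed_family_closed F hF
    (eq_empty_of_forall_notMem fun t ⟨htw, ht⟩ => (hw t ht).not_gt
      (lt_of_lt_of_le (lt_add_of_pos_right _ hη) htw)) hanti.directed_ge
  filter_upwards [eventually_ge_atTop i] with k hk t ht
  by_contra! hlt
  exact notMem_empty t (hi ▸ ⟨hlt.le, hanti hk ht⟩)

theorem exists_forall_le_add_of_iInter [CompactSpace T] {ι : Type*} [Nonempty ι] [LinearOrder ι]
    {ζ : Ordinal} {f : ι → Ordinal} (hf : Monotone f)
    (hζ : ∀ ε A, clIterDeriv d ε ζ A = ⋂ i, clIterDeriv d ε (f i) A) (hS : IsClosedStep S)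
    {g : T → ℝ} (hg : Continuous g) {a δ : ℝ} {J : ℕ}
    (h : ∀ p ∈ S, ∀ j ≤ J, ∀ t ∈ clIterDeriv d (j * δ) ζ p.1, p.2 + a * (j * δ) ≤ g t)
    {η : ℝ} (hη : 0 < η) :
    ∃ i, ∀ p ∈ S, ∀ j ≤ J, ∀ t ∈ clIterDeriv d (j * δ) (f i) p.1,
      p.2 + a * (j * δ) ≤ g t + η := by
  refine Eventually.exists (f := atTop) <| (eventually_all_finite hS.1).2 fun p hp =>
    (eventually_all_finite (finite_Iic J)).2 fun j hj =>
      eventually_forall_le_add (F := fun i => clIterDeriv d (j * δ) (f i) p.1)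
        (fun i => isClosed_clIterDeriv _ _ (hS.2 p hp))
        (fun _ _ hi => clIterDeriv_antitone _ _ (hf hi)) hg (fun t ht => ?_) hη
  rw [← hζ] at ht
  exact h p hp j hj t ht

theorem IsMajorant.exists_iterate_shift [CompactSpace T] {ξ : Ordinal} {a δ : ℝ} (ha : 0 ≤ a)
    (hδ : 0 ≤ δ) {J : ℕ} (hS : IsClosedStep S) {g : T → ℝ} (hg : Continuous g)
    (h : IsMajorant g (shift d (ξ + 1) a δ J S)) {η : ℝ} (hη : 0 < η) :
    ∃ n : ℕ, n ≠ 0 ∧ IsMajorant (fun t => g t + η) ((shift d ξ (a / n) δ J)^[n] S) := by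
  obtain ⟨N, hN⟩ := exists_forall_le_add_of_iInter (f := fun n : ℕ => ω ^ ξ * n)
    (fun _ _ h => by dsimp only; gcongr) (fun ε => clIterDeriv_opow_add_one ε ξ) hS hg
    (isMajorant_shift_iff.1 h) (half_pos hη)
  obtain ⟨k, hk⟩ := exists_nat_gt (a * (N * J * δ) / (η / 2))
  set n := N + k + 1
  have hn : (0 : ℝ) < n := by positivity
  have hkn : (k : ℝ) ≤ n := by norm_cast; omega
  have hsmall : a / n * (N * J * δ) ≤ η / 2 := by
    rw [div_mul_eq_mul_div, div_le_iff₀ hn, ← div_le_iff₀' (half_pos hη)]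
    exact hk.le.trans hkn
  refine ⟨n, by omega, fun q hq t ht => ?_⟩
  obtain ⟨p, hp, l, hlen, hl, rfl⟩ := exists_of_mem_iterate_shift hq
  obtain ⟨j, hj, hjN, hsum⟩ := exists_le_countP_and_sum_le (N := N) hl (by omega)
  have htj : p.2 + a * (j * δ) ≤ g t + η / 2 := hN p hp j hj t <|
    clIterDeriv_antitone _ _ (by gcongr) (clMultiDeriv_map_mul_subset ξ hδ j l p.1 ht)
  have hsum' : (l.sum : ℝ) ≤ n * j + N * J := by rw [← hlen]; exact_mod_cast hsum
  calc p.2 + a / n * (l.sum * δ) ≤ p.2 + a / n * ((n * j + N * J) * δ) := by gcongr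
    _ = p.2 + a * (j * δ) + a / n * (N * J * δ) := by field_simp; ring
    _ ≤ g t + η / 2 + η / 2 := by gcongr
    _ = g t + η := by ring

theorem IsMajorant.exists_shift_of_limit [CompactSpace T] {ξ : Ordinal}
    (hξ : Order.IsSuccLimit ξ) {a δ : ℝ} {J : ℕ} (hS : IsClosedStep S) {g : T → ℝ}
    (hg : Continuous g) (h : IsMajorant g (shift d ξ a δ J S)) {η : ℝ} (hη : 0 < η) :
    ∃ ν < ξ, IsMajorant (fun t => g t + η) (shift d ν a δ J S) := by
  have : Nonempty (Iio ξ) := ⟨⟨0, hξ.bot_lt⟩⟩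
  obtain ⟨ν, hν⟩ := exists_forall_le_add_of_iInter (f := fun ν : Iio ξ => ω ^ (ν : Ordinal))
    (fun _ _ h => Ordinal.opow_le_opow_right Ordinal.omega0_pos h)
    (fun ε => clIterDeriv_opow_limit ε hξ) hS hg (isMajorant_shift_iff.1 h) hη
  exact ⟨ν, ν.2, isMajorant_shift_iff.2 hν⟩

end Averaging

section Raising

variable {𝕜 E T : Type*} [RCLike 𝕜] [NormedAddCommGroup E] [NormedSpace 𝕜 E]
variable [TopologicalSpace T] {d : T → T → ℝ} {Φ : T → StrongDual 𝕜 E}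
variable {D : Set (WeakDual 𝕜 E) → Set (WeakDual 𝕜 E)}

/-- Iterated `ω ^ ξ` times, the operation `D` on sets of functionals raises the level of envelopes
by `a * θ`, while the derived sets of level `b` on `T` raise the step function by `a * b`. -/
def RaisesEnvelope (D : Set (WeakDual 𝕜 E) → Set (WeakDual 𝕜 E)) (Φ : T → StrongDual 𝕜 E)
    (d : T → T → ℝ) (δ : ℝ) (J : ℕ) (θ : ℝ) (ξ : Ordinal) : Prop :=
  ∀ a : ℝ, 0 ≤ a → ∀ S : Set (Set T × ℝ), IsClosedStep S → ∀ r : ℝ,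
    transIter D (ω ^ ξ) (envelope Φ S r) ⊆ envelope Φ (shift d ξ a δ J S) (r + a * θ)

theorem RaisesEnvelope.iterate {δ : ℝ} {J : ℕ} {θ : ℝ} {ξ : Ordinal}
    (h : RaisesEnvelope D Φ d δ J θ ξ) (hsub : ∀ A, D A ⊆ A)
    (hmono : ∀ A B, A ⊆ B → D A ⊆ D B) {a : ℝ} (ha : 0 ≤ a) {S : Set (Set T × ℝ)}
    (hS : IsClosedStep S) (r : ℝ) (n : ℕ) :
    IsClosedStep ((shift d ξ a δ J)^[n] S) ∧ transIter D (ω ^ ξ * n) (envelope Φ S r) ⊆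
      envelope Φ ((shift d ξ a δ J)^[n] S) (r + n * (a * θ)) := by
  induction n with
  | zero => simpa using hS
  | succ n ih =>
    rw [Function.iterate_succ_apply', Nat.cast_add_one, mul_add_one, transIter_add hsub]
    refine ⟨ih.1.shift d ξ a δ J, (transIter_mono hmono _ ih.2).trans ?_⟩
    refine (h a ha _ ih.1 _).trans (envelope_anti (le_of_eq ?_))
    push_cast
    ring

variable [CompactSpace T]

theorem RaisesEnvelope.add_one (hΦ : ∀ u, Continuous fun t => Φ t u) {δ : ℝ} (hδ : 0 ≤ δ)
    {J : ℕ} {θ : ℝ} {ξ : Ordinal} (h : RaisesEnvelope D Φ d δ J θ ξ) (hsub : ∀ A, D A ⊆ A)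
    (hmono : ∀ A B, A ⊆ B → D A ⊆ D B) : RaisesEnvelope D Φ d δ J θ (ξ + 1) := by
  intro a ha S hS r x hx u c hc
  refine le_of_forall_pos_le_add fun η hη => ?_
  obtain ⟨n, hn, hmaj⟩ := hc.exists_iterate_shift (g := fun t => re (Φ t u) + c) ha hδ hS
    ((continuous_re.comp (hΦ u)).add continuous_const) hη
  rw [transIter_opow_add_one hsub] at hx
  have hxn := (h.iterate hsub hmono (div_nonneg ha n.cast_nonneg) hS r n).2 (mem_iInter.1 hx n)
  calc r + a * θ = r + n * (a / n * θ) := by field_simp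
    _ ≤ re (x u) + (c + η) := hxn u (c + η) (by simpa only [add_assoc] using hmaj)
    _ = re (x u) + c + η := (add_assoc _ _ _).symm

theorem RaisesEnvelope.of_limit (hΦ : ∀ u, Continuous fun t => Φ t u) {δ : ℝ} {J : ℕ} {θ : ℝ}
    {ξ : Ordinal} (hξ : Order.IsSuccLimit ξ) (h : ∀ ν < ξ, RaisesEnvelope D Φ d δ J θ ν)
    (hsub : ∀ A, D A ⊆ A) : RaisesEnvelope D Φ d δ J θ ξ := by
  intro a ha S hS r x hx u c hc
  refine le_of_forall_pos_le_add fun η hη => ?_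
  obtain ⟨ν, hν, hmaj⟩ := hc.exists_shift_of_limit (g := fun t => re (Φ t u) + c) hξ hS
    ((continuous_re.comp (hΦ u)).add continuous_const) hη
  rw [transIter_opow_limit hsub hξ] at hx
  have hxν := h ν hν a ha S hS r (mem_iInter.1 hx ⟨ν, hν⟩)
  rw [add_assoc]
  exact hxν u (c + η) (by simpa only [add_assoc] using hmaj)

end Raising

section Summation

variable {𝕜 E T : Type*} [RCLike 𝕜] [NormedAddCommGroup E] [NormedSpace 𝕜 E]

theorem pointDeriv_subset (ε : ℝ) (K : Set (WeakDual 𝕜 E)) : pointDeriv ε K ⊆ K :=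
  sep_subset _ _

theorem pointDeriv_mono (ε : ℝ) (K L : Set (WeakDual 𝕜 E)) (h : K ⊆ L) :
    pointDeriv ε K ⊆ pointDeriv ε L :=
  fun _ hx => ⟨h hx.1, fun V hV => (hx.2 V hV).trans_le
    (Metric.ediam_mono (image_mono (inter_subset_inter_right V h)))⟩

theorem iterDeriv_of_nonpos {ε : ℝ} (hε : ε ≤ 0) (ζ : Ordinal) (K : Set (WeakDual 𝕜 E)) :
    iterDeriv ε ζ K = K :=
  if_pos hε

theorem iterDeriv_of_pos {ε : ℝ} (hε : 0 < ε) (ζ : Ordinal) (K : Set (WeakDual 𝕜 E)) :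
    iterDeriv ε ζ K = transIter (pointDeriv ε) ζ K :=
  if_neg hε.not_ge

theorem iterDeriv_mono (ε : ℝ) (ζ : Ordinal) {K L : Set (WeakDual 𝕜 E)} (h : K ⊆ L) :
    iterDeriv ε ζ K ⊆ iterDeriv ε ζ L := by
  rcases le_or_gt ε 0 with hε | hε
  · simpa only [iterDeriv_of_nonpos hε] using h
  · simpa only [iterDeriv_of_pos hε] using transIter_mono (pointDeriv_mono ε) ζ h

theorem multiDeriv_cons (ξ : Ordinal) (ε : ℝ) (l : List ℝ) (K : Set (WeakDual 𝕜 E)) :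
    multiDeriv ξ (ε :: l) K = iterDeriv ε (ω ^ ξ) (multiDeriv ξ l K) := rfl

theorem exists_nonempty_of_mem_envelope {Φ : T → StrongDual 𝕜 E} {S : Set (Set T × ℝ)}
    (hS : S.Finite) {r : ℝ} {x : WeakDual 𝕜 E} (hx : x ∈ envelope Φ S r) :
    ∃ p ∈ S, p.1.Nonempty ∧ r ≤ p.2 := by
  by_contra! hlt
  have hev : ∀ᶠ c in 𝓝[<] r, ∀ p ∈ S, p.1.Nonempty → p.2 ≤ c :=
    (eventually_all_finite hS).2 fun p hp => eventually_imp_distrib_left.2 fun hne =>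
      nhdsWithin_le_nhds (Ici_mem_nhds (hlt p hp hne))
  obtain ⟨c, hc, hcr⟩ := (hev.and self_mem_nhdsWithin).exists
  have hr : r ≤ c := by
    simpa using hx 0 c fun p hp t ht => by simpa using hc p hp ⟨t, ht⟩
  exact hr.not_gt hcr

variable [TopologicalSpace T] [CompactSpace T] {Φ : T → StrongDual 𝕜 E} {d : T → T → ℝ}

theorem raisesEnvelope_pointDeriv (hΦ : ∀ u, Continuous fun t => Φ t u)
    (hd : ∀ s t, dist (Φ s) (Φ t) ≤ d s t) {δ : ℝ} (hδ : 0 ≤ δ) {J : ℕ}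
    (hR : ∀ s t, d s t ≤ J * δ) (ε : ℝ) (ξ : Ordinal) :
    RaisesEnvelope (pointDeriv ε) Φ d δ J (ε / 4 - δ) ξ := by
  induction ξ using Ordinal.limitRecOn with
  | zero =>
    intro a ha S hS r
    rw [Ordinal.opow_zero, transIter_one]
    exact pointDeriv_envelope_subset hΦ hd ha hδ hR hS ε r
  | add_one ξ ih => exact ih.add_one hΦ hδ (pointDeriv_subset ε) (pointDeriv_mono ε)
  | limit ξ hξ ih => exact .of_limit hΦ hξ ih (pointDeriv_subset ε)

theorem iterDeriv_envelope_subset (hΦ : ∀ u, Continuous fun t => Φ t u)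
    (hd : ∀ s t, dist (Φ s) (Φ t) ≤ d s t) {a δ : ℝ} (ha : 0 ≤ a) (hδ : 0 ≤ δ) {J : ℕ}
    (hR : ∀ s t, d s t ≤ J * δ) {S : Set (Set T × ℝ)} (hS : IsClosedStep S) (ε : ℝ)
    (ξ : Ordinal) (r : ℝ) : iterDeriv ε (ω ^ ξ) (envelope Φ S r) ⊆
      envelope Φ (shift d ξ a δ J S) (r + a * (ε / 4 - δ)) := by
  rcases le_or_gt ε 0 with hε | hε
  · rw [iterDeriv_of_nonpos hε]
    refine (envelope_subset_envelope_shift ξ a δ J r).trans (envelope_anti ?_)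
    linarith [mul_nonpos_of_nonneg_of_nonpos ha (by linarith : ε / 4 - δ ≤ 0)]
  · rw [iterDeriv_of_pos hε]
    exact raisesEnvelope_pointDeriv hΦ hd hδ hR ε ξ a ha S hS r

theorem exists_multiDeriv_subset_envelope (hΦ : ∀ u, Continuous fun t => Φ t u)
    (hd : ∀ s t, dist (Φ s) (Φ t) ≤ d s t) {δ : ℝ} (hδ : 0 ≤ δ) {J : ℕ}
    (hR : ∀ s t, d s t ≤ J * δ) (ξ : Ordinal) {C : Set (WeakDual 𝕜 E)}
    (hC : C ⊆ envelope Φ {(univ, 0)} 0) {g : ℝ → ℝ} {l : List ℝ} (hg : ∀ ε ∈ l, 0 ≤ g ε) :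
    ∃ S : Set (Set T × ℝ), IsClosedStep S ∧
      multiDeriv ξ l C ⊆ envelope Φ S (l.map fun ε => g ε * (ε / 4 - δ)).sum ∧
      ∀ p ∈ S, ∃ L : List (ℝ × ℝ), L.map Prod.fst = l ∧ (∀ e ∈ L, 0 ≤ e.2) ∧
        p = (clMultiDeriv d ξ (L.map Prod.snd) univ, (L.map fun e => g e.1 * e.2).sum) := by
  induction l with
  | nil =>
    refine ⟨{(univ, 0)}, ⟨finite_singleton _, by simp⟩, hC, ?_⟩
    rintro _ rfl
    exact ⟨[], by simp⟩
  | cons ε l ih =>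
    obtain ⟨S, hS, hsub, hlist⟩ := ih fun ε' h => hg ε' (List.mem_cons_of_mem _ h)
    refine ⟨shift d ξ (g ε) δ J S, hS.shift d ξ (g ε) δ J, ?_, ?_⟩
    · rw [multiDeriv_cons, List.map_cons, List.sum_cons, add_comm]
      exact (iterDeriv_mono ε _ hsub).trans
        (iterDeriv_envelope_subset hΦ hd (hg ε List.mem_cons_self) hδ hR hS ε ξ _)
    · rintro _ ⟨p, hp, j, -, rfl⟩
      obtain ⟨L, rfl, hL, rfl⟩ := hlist p hp
      refine ⟨(ε, j * δ) :: L, rfl, List.forall_mem_cons.2 ⟨by positivity, hL⟩, ?_⟩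
      rw [List.map_cons, clMultiDeriv_cons, List.map_cons, List.sum_cons, add_comm]

theorem exists_clMultiDeriv_nonempty (hΦ : ∀ u, Continuous fun t => Φ t u)
    (hd : ∀ s t, dist (Φ s) (Φ t) ≤ d s t) {R : ℝ} (hR : ∀ s t, d s t ≤ R) (ξ : Ordinal)
    {C : Set (WeakDual 𝕜 E)} (hC : C ⊆ envelope Φ {(univ, 0)} 0) {g : ℝ → ℝ} {l : List ℝ}
    (hg : ∀ ε ∈ l, 0 ≤ g ε) (hne : (multiDeriv ξ l C).Nonempty) {η : ℝ} (hη : 0 < η) :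
    ∃ L : List (ℝ × ℝ), L.map Prod.fst = l ∧ (∀ e ∈ L, 0 ≤ e.2) ∧
      (clMultiDeriv d ξ (L.map Prod.snd) univ).Nonempty ∧
      (L.map fun e => g e.1 * e.1).sum / 4 ≤ (L.map fun e => g e.1 * e.2).sum + η := by
  have hsum : 0 ≤ (l.map g).sum := List.sum_nonneg (by simpa using hg)
  set δ := η / ((l.map g).sum + 1)
  have hδ : 0 < δ := by positivity
  obtain ⟨J, hJ⟩ := exists_nat_ge (R / δ)
  obtain ⟨S, hS, hsub, hlist⟩ := exists_multiDeriv_subset_envelope hΦ hd hδ.le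
    (fun s t => (hR s t).trans ((div_le_iff₀ hδ).1 hJ)) ξ hC hg
  have hsmall : (l.map g).sum * δ ≤ η := by
    rw [mul_div_assoc', div_le_iff₀ (by positivity)]
    linarith
  have hexpand : (l.map fun ε => g ε * ε).sum / 4 =
      (l.map fun ε => g ε * (ε / 4 - δ)).sum + (l.map g).sum * δ := by
    rw [div_eq_mul_inv, ← List.sum_map_mul_right, ← List.sum_map_mul_right, ← List.sum_map_add]
    congr! 3
    ring
  obtain ⟨p, hp, hpne, hle⟩ := exists_nonempty_of_mem_envelope hS.1 (hsub hne.some_mem)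
  obtain ⟨L, rfl, hL, rfl⟩ := hlist p hp
  refine ⟨L, rfl, hL, hpne, ?_⟩
  rw [List.map_map] at hexpand
  exact hexpand.trans_le (add_le_add hle hsmall)

theorem rpow_sub_one_mul_self {q : ℝ} (hq : 1 ≤ q) {x : ℝ} (hx : 0 ≤ x) :
    x ^ (q - 1) * x = x ^ q := by
  rw [← Real.rpow_add_one' hx (by linarith), sub_add_cancel]

theorem rpow_sub_one_mul_le {q : ℝ} (hq : 1 ≤ q) {c x y : ℝ} (hc : 0 < c) (hx : 0 ≤ x)
    (hy : 0 ≤ y) : x ^ (q - 1) * y ≤ c⁻¹ * x ^ q + c ^ (q - 1) * y ^ q := by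
  rcases le_total (c * y) x with h | h
  · have hyx : y ≤ c⁻¹ * x := by rwa [← div_eq_inv_mul, le_div_iff₀' hc]
    calc x ^ (q - 1) * y ≤ x ^ (q - 1) * (c⁻¹ * x) := by gcongr
      _ = c⁻¹ * x ^ q := by rw [← rpow_sub_one_mul_self hq hx]; ring
      _ ≤ _ := le_add_of_nonneg_right (by positivity)
  · calc x ^ (q - 1) * y ≤ (c * y) ^ (q - 1) * y := by gcongr
      _ = c ^ (q - 1) * y ^ q := by
          rw [Real.mul_rpow hc.le hy, mul_assoc, rpow_sub_one_mul_self hq hy]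
      _ ≤ _ := le_add_of_nonneg_left (by positivity)

/-- The weights `ε ^ (q - 1)` turn the comparison of weighted sums into
`∑ ε ^ q / 4 ≤ ∑ ε ^ (q - 1) * b`, up to `η`, and Young's inequality absorbs half of the left-hand
side. -/
theorem sum_rpow_le_of_multiDeriv_nonempty (hΦ : ∀ u, Continuous fun t => Φ t u)
    (hd : ∀ s t, dist (Φ s) (Φ t) ≤ d s t) {R : ℝ} (hR : ∀ s t, d s t ≤ R) (ξ : Ordinal)
    {q : ℝ} (hq : 1 ≤ q) {C : Set (WeakDual 𝕜 E)} (hC : C ⊆ envelope Φ {(univ, 0)} 0) {B : ℝ}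
    (hB : ∀ l : List ℝ, (∀ b ∈ l, 0 ≤ b) → (clMultiDeriv d ξ l univ).Nonempty →
      (l.map fun b => b ^ q).sum ≤ B)
    {l : List ℝ} (hl : ∀ ε ∈ l, 0 ≤ ε) (hne : (multiDeriv ξ l C).Nonempty) :
    (l.map fun ε => ε ^ q).sum ≤ 8 ^ q * B := by
  refine le_of_forall_pos_le_add fun η hη => ?_
  obtain ⟨L, rfl, hL, hLne, hsum⟩ := exists_clMultiDeriv_nonempty hΦ hd hR ξ hC
    (g := fun ε => ε ^ (q - 1)) (fun ε hε => Real.rpow_nonneg (hl ε hε) _) hne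
    (by positivity : 0 < η / 8)
  have hB' := hB _ (List.forall_mem_map.2 hL) hLne
  have hyoung : (L.map fun e => e.1 ^ (q - 1) * e.2).sum ≤
      8⁻¹ * (L.map fun e => e.1 ^ q).sum + 8 ^ (q - 1) * (L.map fun e => e.2 ^ q).sum := by
    rw [← List.sum_map_mul_left, ← List.sum_map_mul_left, ← List.sum_map_add]
    exact List.sum_le_sum fun e he => rpow_sub_one_mul_le hq (by norm_num)
      (hl _ (List.mem_map_of_mem he)) (hL e he)
  have hpow : (L.map fun e => e.1 ^ (q - 1) * e.1) = L.map fun e => e.1 ^ q :=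
    List.map_congr_left fun e he => rpow_sub_one_mul_self hq (hl _ (List.mem_map_of_mem he))
  rw [hpow] at hsum
  rw [List.map_map] at hB' ⊢
  have hscale := mul_le_mul_of_nonneg_left hB'
    (Real.rpow_nonneg (by norm_num : (0 : ℝ) ≤ 8) (q - 1))
  rw [← rpow_sub_one_mul_self hq (by norm_num : (0 : ℝ) ≤ 8)]
  simp only [Function.comp_def] at hscale ⊢
  linarith

end Summation

section Comparison

variable {𝕜 E T : Type*} [RCLike 𝕜] [NormedAddCommGroup E] [NormedSpace 𝕜 E]
variable [TopologicalSpace T] {φ : T → WeakDual 𝕜 E} {d : T → T → ℝ} {c : ℝ}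

theorem clDeriv_subset_preimage_pointDeriv (hφ : Continuous φ) (hc : 0 < c)
    (hd : ∀ s t, d s t ≤ c * dist (WeakDual.toStrongDual (φ s)) (WeakDual.toStrongDual (φ t)))
    {ε : ℝ} (hε : 0 < ε) (A : Set T) (B : Set (WeakDual 𝕜 E)) (h : A ⊆ φ ⁻¹' B) :
    clDeriv d ε A ⊆ φ ⁻¹' pointDeriv (ε / c) B := by
  rintro t ⟨htA, ht⟩
  refine ⟨h htA, fun V hV => ?_⟩
  obtain ⟨U, hUV, hU, htU⟩ := mem_nhds_iff.1 hV
  obtain ⟨s, hsU, hsA, hs⟩ := mem_closure_iff.1 ht _ (hU.preimage hφ) htU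
  obtain ⟨y, hsy, hyU, hyA⟩ := (hs.and_eventually
    ((eventually_nhdsWithin_of_eventually_nhds ((hU.preimage hφ).mem_nhds hsU)).and
      eventually_mem_nhdsWithin)).exists
  calc ENNReal.ofReal (ε / c)
      < edist (WeakDual.toStrongDual (φ s)) (WeakDual.toStrongDual (φ y)) := by
        rw [edist_dist, ENNReal.ofReal_lt_ofReal_iff_of_nonneg (by positivity), div_lt_iff₀' hc]
        exact (hsy hε).trans_le (hd s y)
    _ ≤ Metric.ediam (WeakDual.toStrongDual '' (V ∩ B)) :=
        Metric.edist_le_ediam_of_mem (mem_image_of_mem _ ⟨hUV hsU, h hsA⟩)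
          (mem_image_of_mem _ ⟨hUV hyU, h hyA⟩)

theorem clIterDeriv_subset_preimage (hφ : Continuous φ) (hc : 0 < c)
    (hd : ∀ s t, d s t ≤ c * dist (WeakDual.toStrongDual (φ s)) (WeakDual.toStrongDual (φ t)))
    (ε : ℝ) (ζ : Ordinal) {A : Set T} {B : Set (WeakDual 𝕜 E)} (h : A ⊆ φ ⁻¹' B) :
    clIterDeriv d ε ζ A ⊆ φ ⁻¹' iterDeriv (ε / c) ζ B := by
  rcases le_or_gt ε 0 with hε | hε
  · rwa [clIterDeriv_of_nonpos hε, iterDeriv_of_nonpos (div_nonpos_of_nonpos_of_nonneg hε hc.le)]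
  · rw [iterDeriv_of_pos (div_pos hε hc)]
    exact transIter_subset_preimage (clDeriv_subset_preimage_pointDeriv hφ hc hd hε) ζ h

theorem clMultiDeriv_subset_preimage (hφ : Continuous φ) (hc : 0 < c)
    (hd : ∀ s t, d s t ≤ c * dist (WeakDual.toStrongDual (φ s)) (WeakDual.toStrongDual (φ t)))
    (ξ : Ordinal) (l : List ℝ) {A : Set T} {B : Set (WeakDual 𝕜 E)} (h : A ⊆ φ ⁻¹' B) :
    clMultiDeriv d ξ l A ⊆ φ ⁻¹' multiDeriv ξ (l.map (· / c)) B := by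
  induction l with
  | nil => exact h
  | cons ε l ih => exact clIterDeriv_subset_preimage hφ hc hd ε _ ih

theorem SetSummableWith.sum_rpow_le {M q : ℝ} {ξ : Ordinal} {K : Set (WeakDual 𝕜 E)}
    (hK : SetSummableWith M ξ q K) (hφ : Continuous φ) (hφK : ∀ t, φ t ∈ K) (hc : 0 < c)
    (hd : ∀ s t, d s t ≤ c * dist (WeakDual.toStrongDual (φ s)) (WeakDual.toStrongDual (φ t)))
    {l : List ℝ} (hl : ∀ b ∈ l, 0 ≤ b) (hne : (clMultiDeriv d ξ l univ).Nonempty) :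
    (l.map fun b => b ^ q).sum ≤ c ^ q * M ^ q := by
  have hsum := hK (l.map (· / c)) (List.forall_mem_map.2 fun b hb => div_nonneg (hl b hb) hc.le)
    (nonempty_of_nonempty_preimage
      (hne.mono (clMultiDeriv_subset_preimage hφ hc hd ξ l fun t _ => hφK t)))
  have hscale : l.map (fun b => b ^ q) = l.map fun b => c ^ q * (b / c) ^ q :=
    List.map_congr_left fun b hb => by
      rw [← Real.mul_rpow hc.le (div_nonneg (hl b hb) hc.le), mul_div_cancel₀ b hc.ne']
  rw [hscale, List.sum_map_mul_left]
  rw [List.map_map] at hsum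
  exact mul_le_mul_of_nonneg_left hsum (by positivity)

end Comparison

section ProductSummability

variable {𝕜 E X₀ X₁ : Type*} [RCLike 𝕜] [NormedAddCommGroup E] [NormedSpace 𝕜 E]
  [NormedAddCommGroup X₀] [NormedSpace 𝕜 X₀] [NormedAddCommGroup X₁] [NormedSpace 𝕜 X₁]
  {K₀ : Set (WeakDual 𝕜 X₀)} {K₁ : Set (WeakDual 𝕜 X₁)}

theorem sum_rpow_le_of_clMultiDeriv_maxDist_nonempty {M₀ M₁ q : ℝ} {ξ : Ordinal}
    (h₀ : SetSummableWith M₀ ξ q K₀) (h₁ : SetSummableWith M₁ ξ q K₁) {c : ℝ} (hc : 0 < c)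
    {l : List ℝ} (hl : ∀ b ∈ l, 0 ≤ b)
    (hne : (clMultiDeriv (maxDist
      (fun s t : K₀ => c * dist (WeakDual.toStrongDual s.1) (WeakDual.toStrongDual t.1))
      (fun s t : K₁ => c * dist (WeakDual.toStrongDual s.1) (WeakDual.toStrongDual t.1)))
      ξ l univ).Nonempty) :
    (l.map fun b => b ^ q).sum ≤ c ^ q * M₀ ^ q + c ^ q * M₁ ^ q := by
  obtain ⟨p, hp⟩ := hne
  rw [← univ_prod_univ] at hp
  obtain ⟨l₀, l₁, hperm, hp₀, hp₁⟩ :=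
    exists_perm_of_mem_clMultiDeriv_prod ξ l isClosed_univ isClosed_univ hp
  have hmem : ∀ b ∈ l₀ ++ l₁, 0 ≤ b := fun b hb => hl b (hperm.mem_iff.2 hb)
  rw [(hperm.map _).sum_eq, List.map_append, List.sum_append]
  exact add_le_add
    (h₀.sum_rpow_le continuous_subtype_val Subtype.property hc (fun _ _ => le_rfl)
      (fun b hb => hmem b (List.mem_append_left _ hb)) ⟨_, hp₀⟩)
    (h₁.sum_rpow_le continuous_subtype_val Subtype.property hc (fun _ _ => le_rfl)
      (fun b hb => hmem b (List.mem_append_right _ hb)) ⟨_, hp₁⟩)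

theorem SetSummable.of_subset_envelope_prod {ξ : Ordinal} {q : ℝ} (hq : 1 ≤ q)
    (hK₀ : IsCompact K₀) (hK₁ : IsCompact K₁)
    (hb₀ : Bornology.IsBounded (WeakDual.toStrongDual '' K₀))
    (hb₁ : Bornology.IsBounded (WeakDual.toStrongDual '' K₁))
    (h₀ : SetSummable ξ q K₀) (h₁ : SetSummable ξ q K₁) {Φ : K₀ × K₁ → StrongDual 𝕜 E}
    (hΦ : ∀ u, Continuous fun p => Φ p u) {c : ℝ} (hc : 0 < c)
    (hd : ∀ s t u, ‖Φ s u - Φ t u‖ ≤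
      max (c * dist (WeakDual.toStrongDual s.1.1) (WeakDual.toStrongDual t.1.1))
        (c * dist (WeakDual.toStrongDual s.2.1) (WeakDual.toStrongDual t.2.1)) * ‖u‖)
    {C : Set (WeakDual 𝕜 E)} (hC : C ⊆ envelope Φ {(univ, 0)} 0) : SetSummable ξ q C := by
  obtain ⟨M₀, hM₀, h₀⟩ := h₀
  obtain ⟨M₁, hM₁, h₁⟩ := h₁
  obtain ⟨R₀, hR₀⟩ := Metric.isBounded_iff.1 hb₀
  obtain ⟨R₁, hR₁⟩ := Metric.isBounded_iff.1 hb₁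
  have := isCompact_iff_compactSpace.1 hK₀
  have := isCompact_iff_compactSpace.1 hK₁
  have hdist : ∀ s t, dist (Φ s) (Φ t) ≤
      max (c * dist (WeakDual.toStrongDual s.1.1) (WeakDual.toStrongDual t.1.1))
        (c * dist (WeakDual.toStrongDual s.2.1) (WeakDual.toStrongDual t.2.1)) := fun s t => by
    rw [dist_eq_norm]
    exact (Φ s - Φ t).opNorm_le_bound (le_max_of_le_left (by positivity)) (hd s t)
  set B := c ^ q * M₀ ^ q + c ^ q * M₁ ^ q
  have hR : ∀ s t : K₀ × K₁,
      max (c * dist (WeakDual.toStrongDual s.1.1) (WeakDual.toStrongDual t.1.1))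
        (c * dist (WeakDual.toStrongDual s.2.1) (WeakDual.toStrongDual t.2.1)) ≤
      max (c * R₀) (c * R₁) := fun s t => by
    gcongr
    · exact hR₀ (mem_image_of_mem _ s.1.2) (mem_image_of_mem _ t.1.2)
    · exact hR₁ (mem_image_of_mem _ s.2.2) (mem_image_of_mem _ t.2.2)
  refine ⟨(8 ^ q * B) ^ q⁻¹, by positivity, fun l hl hne => ?_⟩
  rw [Real.rpow_inv_rpow (by positivity) (by linarith)]
  exact sum_rpow_le_of_multiDeriv_nonempty hΦ hdist hR ξ hq hC
    (fun _ => sum_rpow_le_of_clMultiDeriv_maxDist_nonempty h₀ h₁ hc) hl hne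

end ProductSummability

section TensorProduct

variable {𝕜 : Type*} [RCLike 𝕜]
variable {X₀ X₁ : Type*} [NormedAddCommGroup X₀] [NormedSpace 𝕜 X₀]
  [NormedAddCommGroup X₁] [NormedSpace 𝕜 X₁]

/-- The functional `x₀ ⊗ x₁ : u ↦ x₀ (u x₁)` on the injective tensor product. -/
def tensorFunctional (x₀ : StrongDual 𝕜 X₀) (x₁ : StrongDual 𝕜 X₁) :
    StrongDual 𝕜 (InjTensor 𝕜 X₀ X₁) :=
  x₀.comp ((ContinuousLinearMap.apply 𝕜 X₀ x₁).comp (InjTensor 𝕜 X₀ X₁).subtypeL)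

theorem tensorFunctional_apply (x₀ : StrongDual 𝕜 X₀) (x₁ : StrongDual 𝕜 X₁)
    (u : InjTensor 𝕜 X₀ X₁) : tensorFunctional x₀ x₁ u = x₀ (u.1 x₁) := rfl

theorem norm_tensorFunctional_apply_le (x₀ : StrongDual 𝕜 X₀) (x₁ : StrongDual 𝕜 X₁)
    (u : InjTensor 𝕜 X₀ X₁) : ‖tensorFunctional x₀ x₁ u‖ ≤ ‖x₀‖ * ‖x₁‖ * ‖u‖ :=
  calc ‖x₀ (u.1 x₁)‖ ≤ ‖x₀‖ * (‖u.1‖ * ‖x₁‖) := x₀.le_opNorm_of_le (u.1.le_opNorm x₁)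
    _ = ‖x₀‖ * ‖x₁‖ * ‖u‖ := by rw [mul_comm ‖u.1‖, ← mul_assoc, Submodule.coe_norm]

theorem norm_tensorFunctional_apply_sub_le {x₀ y₀ : StrongDual 𝕜 X₀} {x₁ y₁ : StrongDual 𝕜 X₁}
    {R : ℝ} (hx₁ : ‖x₁‖ ≤ R) (hy₀ : ‖y₀‖ ≤ R) (u : InjTensor 𝕜 X₀ X₁) :
    ‖tensorFunctional x₀ x₁ u - tensorFunctional y₀ y₁ u‖ ≤
      max (2 * R * dist x₀ y₀) (2 * R * dist x₁ y₁) * ‖u‖ := by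
  have hsplit : tensorFunctional x₀ x₁ u - tensorFunctional y₀ y₁ u =
      tensorFunctional (x₀ - y₀) x₁ u + tensorFunctional y₀ (x₁ - y₁) u := by
    simp [tensorFunctional_apply]
  rw [hsplit, dist_eq_norm, dist_eq_norm]
  calc ‖tensorFunctional (x₀ - y₀) x₁ u + tensorFunctional y₀ (x₁ - y₁) u‖
      ≤ ‖x₀ - y₀‖ * ‖x₁‖ * ‖u‖ + ‖y₀‖ * ‖x₁ - y₁‖ * ‖u‖ :=
        norm_add_le_of_le (norm_tensorFunctional_apply_le _ _ u)
          (norm_tensorFunctional_apply_le _ _ u)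
    _ ≤ ‖x₀ - y₀‖ * R * ‖u‖ + R * ‖x₁ - y₁‖ * ‖u‖ := by gcongr
    _ = (‖x₀ - y₀‖ * R + R * ‖x₁ - y₁‖) * ‖u‖ := by ring
    _ ≤ max (2 * R * ‖x₀ - y₀‖) (2 * R * ‖x₁ - y₁‖) * ‖u‖ := by
        gcongr
        linarith [le_max_left (2 * R * ‖x₀ - y₀‖) (2 * R * ‖x₁ - y₁‖),
          le_max_right (2 * R * ‖x₀ - y₀‖) (2 * R * ‖x₁ - y₁‖)]

section Continuity

variable {T : Type*} [TopologicalSpace T] {φ₀ : T → WeakDual 𝕜 X₀} {φ₁ : T → WeakDual 𝕜 X₁}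

theorem continuous_apply_of_mem_span (h₀ : Continuous φ₀) (h₁ : Continuous φ₁)
    {u : Op 𝕜 (StrongDual 𝕜 X₁) X₀}
    (hu : u ∈ Submodule.span 𝕜 (range fun p : X₀ × X₁ => elemTensor p.1 p.2)) :
    Continuous fun t => φ₀ t (u (WeakDual.toStrongDual (φ₁ t))) := by
  induction hu using Submodule.span_induction with
  | mem u hu =>
    obtain ⟨⟨x, y⟩, rfl⟩ := hu
    simp only [elemTensor_apply, map_smul, smul_eq_mul]
    exact ((WeakDual.eval_continuous y).comp h₁).mul ((WeakDual.eval_continuous x).comp h₀)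
  | zero => simpa using continuous_const
  | add u v _ _ hu hv => simpa [Pi.add_def] using hu.add hv
  | smul c u _ hu => simpa using hu.const_mul c

theorem continuous_tensorFunctional_apply (h₀ : Continuous φ₀) (h₁ : Continuous φ₁) {R : ℝ}
    (hR₀ : ∀ t, ‖WeakDual.toStrongDual (φ₀ t)‖ ≤ R)
    (hR₁ : ∀ t, ‖WeakDual.toStrongDual (φ₁ t)‖ ≤ R) (u : InjTensor 𝕜 X₀ X₁) :
    Continuous fun t => tensorFunctional (WeakDual.toStrongDual (φ₀ t))
      (WeakDual.toStrongDual (φ₁ t)) u := by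
  refine continuous_of_uniform_approx_of_continuous fun V hV => ?_
  obtain ⟨η, hη, hηV⟩ := Metric.mem_uniformity_dist.1 hV
  obtain ⟨v, hv, huv⟩ := Metric.mem_closure_iff.1 u.2 (η / (R ^ 2 + 1)) (by positivity)
  refine ⟨_, continuous_apply_of_mem_span h₀ h₁ hv, fun t => hηV ?_⟩
  have hR : 0 ≤ R := (norm_nonneg _).trans (hR₀ t)
  rw [dist_eq_norm] at huv ⊢
  calc ‖WeakDual.toStrongDual (φ₀ t) (u.1 (WeakDual.toStrongDual (φ₁ t))) -
        WeakDual.toStrongDual (φ₀ t) (v (WeakDual.toStrongDual (φ₁ t)))‖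
      = ‖WeakDual.toStrongDual (φ₀ t) ((u.1 - v) (WeakDual.toStrongDual (φ₁ t)))‖ := by
        rw [sub_apply, map_sub]
    _ ≤ R * (‖u.1 - v‖ * R) := ContinuousLinearMap.le_of_opNorm_le_of_le _ (hR₀ t)
        (ContinuousLinearMap.le_of_opNorm_le_of_le _ le_rfl (hR₁ t))
    _ = ‖u.1 - v‖ * R ^ 2 := by ring
    _ ≤ ‖u.1 - v‖ * (R ^ 2 + 1) := by gcongr; linarith
    _ < η := (lt_div_iff₀ (by positivity)).1 huv

end Continuity

end TensorProduct

section AdjointBall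

variable {𝕜 : Type*} [RCLike 𝕜]

section

variable {X Y : Type*} [NormedAddCommGroup X] [NormedSpace 𝕜 X]
  [NormedAddCommGroup Y] [NormedSpace 𝕜 Y] (A : X →L[𝕜] Y)

theorem isCompact_adjointBall : IsCompact (adjointBall A) := by
  have hcont : Continuous fun y : WeakDual 𝕜 Y =>
      StrongDual.toWeakDual ((WeakDual.toStrongDual y).comp A) :=
    WeakDual.continuous_of_continuous_eval fun x => WeakDual.eval_continuous (A x)
  exact (WeakDual.isCompact_closedBall 0 1).image hcont

variable {A} {x : WeakDual 𝕜 X}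

theorem norm_apply_le_of_mem_adjointBall (hx : x ∈ adjointBall A) (u : X) : ‖x u‖ ≤ ‖A u‖ := by
  obtain ⟨y, hy, rfl⟩ := hx
  simpa using y.le_of_opNorm_le (mem_closedBall_zero_iff.1 hy) (A u)

theorem norm_le_of_mem_adjointBall (hx : x ∈ adjointBall A) : ‖WeakDual.toStrongDual x‖ ≤ ‖A‖ :=
  ContinuousLinearMap.opNorm_le_bound _ (norm_nonneg A) fun u =>
    (norm_apply_le_of_mem_adjointBall hx u).trans (A.le_opNorm u)

variable (A) in
theorem isBounded_adjointBall :
    Bornology.IsBounded (WeakDual.toStrongDual '' adjointBall A) :=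
  isBounded_iff_forall_norm_le.2 ⟨‖A‖, forall_mem_image.2 fun _ => norm_le_of_mem_adjointBall⟩

theorem smul_mem_adjointBall {a : 𝕜} (ha : ‖a‖ ≤ 1) (hx : x ∈ adjointBall A) :
    a • x ∈ adjointBall A := by
  obtain ⟨y, hy, rfl⟩ := hx
  refine ⟨a • y, mem_closedBall_zero_iff.2 ?_, rfl⟩
  rw [norm_smul]
  exact mul_le_one₀ ha (norm_nonneg y) (mem_closedBall_zero_iff.1 hy)

end

theorem mem_envelope_of_forall_norm_le {T E : Type*} [NormedAddCommGroup E] [NormedSpace 𝕜 E]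
    {Φ : T → StrongDual 𝕜 E} (hΦ : ∀ a : 𝕜, ‖a‖ = 1 → ∀ t, ∃ s, Φ s = a • Φ t)
    {x : WeakDual 𝕜 E} (hx : ∀ (u : E) (c : ℝ), (∀ t, ‖Φ t u‖ ≤ c) → ‖x u‖ ≤ c) :
    x ∈ envelope Φ {(univ, 0)} 0 := by
  intro u c hc
  have hnorm : ‖x u‖ ≤ c := by
    refine hx u c fun t => ?_
    obtain ⟨a, ha, hau⟩ := exists_norm_eq_mul_self (Φ t u)
    obtain ⟨s, hs⟩ := hΦ (-a) (by rwa [norm_neg]) t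
    have h : 0 ≤ re (Φ s u) + c := hc _ rfl s (mem_univ s)
    rw [hs, smul_apply, smul_eq_mul, neg_mul, ← hau, map_neg, ofReal_re] at h
    linarith
  linarith [(abs_le.1 ((abs_re_le_norm (x u)).trans hnorm)).1]

variable {X₀ X₁ Y₀ Y₁ : Type*}
  [NormedAddCommGroup X₀] [NormedSpace 𝕜 X₀] [NormedAddCommGroup X₁] [NormedSpace 𝕜 X₁]
  [NormedAddCommGroup Y₀] [NormedSpace 𝕜 Y₀] [NormedAddCommGroup Y₁] [NormedSpace 𝕜 Y₁]
  {A₀ : X₀ →L[𝕜] Y₀} {A₁ : X₁ →L[𝕜] Y₁}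

theorem norm_tensorOp_apply_le {u : InjTensor 𝕜 X₀ X₁} {c : ℝ}
    (h : ∀ x₀ ∈ adjointBall A₀, ∀ x₁ ∈ adjointBall A₁,
      ‖tensorFunctional (WeakDual.toStrongDual x₀) (WeakDual.toStrongDual x₁) u‖ ≤ c) :
    ‖tensorOp A₀ A₁ u‖ ≤ c := by
  change ‖sandwich A₀ A₁ u.1‖ ≤ c
  by_contra! hlt
  obtain ⟨y₁, hy₁, hcy⟩ := ContinuousLinearMap.exists_lt_apply_of_lt_opNorm _ hlt
  obtain ⟨y₀, hy₀, hy⟩ := exists_dual_vector'' 𝕜 (sandwich A₀ A₁ u.1 y₁)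
  have hle : ‖y₀ (sandwich A₀ A₁ u.1 y₁)‖ ≤ c :=
    h _ (mem_image_of_mem _ (mem_closedBall_zero_iff.2 hy₀)) _
      (mem_image_of_mem _ (mem_closedBall_zero_iff.2 hy₁.le))
  rw [hy, norm_ofReal, abs_norm] at hle
  exact hle.not_gt hcy

theorem adjointBall_tensorOp_subset : adjointBall (tensorOp A₀ A₁) ⊆
    envelope (fun p : adjointBall A₀ × adjointBall A₁ =>
      tensorFunctional (WeakDual.toStrongDual p.1.1) (WeakDual.toStrongDual p.2.1))
        {(univ, 0)} 0 :=
  fun _ hx => mem_envelope_of_forall_norm_le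
    (fun _ ha p => ⟨(⟨_, smul_mem_adjointBall ha.le p.1.2⟩, p.2), rfl⟩)
    fun u _ hc => (norm_apply_le_of_mem_adjointBall hx u).trans <|
      norm_tensorOp_apply_le fun x₀ h₀ x₁ h₁ => hc (⟨x₀, h₀⟩, ⟨x₁, h₁⟩)

end AdjointBall

end Szlenk

end

open Szlenk in
theorem mainTheorem6_general {𝕜 : Type*} [RCLike 𝕜]
    {X₀ X₁ Y₀ Y₁ : Type*}
    [NormedAddCommGroup X₀] [NormedSpace 𝕜 X₀] [NormedAddCommGroup X₁] [NormedSpace 𝕜 X₁]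
    [NormedAddCommGroup Y₀] [NormedSpace 𝕜 Y₀] [NormedAddCommGroup Y₁] [NormedSpace 𝕜 Y₁]
    (ξ : Ordinal) (q : ℝ) (hq : 1 ≤ q)
    (A₀ : X₀ →L[𝕜] Y₀) (A₁ : X₁ →L[𝕜] Y₁)
    (h₀ : OperatorSummable ξ q A₀) (h₁ : OperatorSummable ξ q A₁) :
    OperatorSummable ξ q (tensorOp A₀ A₁) := by
  set R := max ‖A₀‖ ‖A₁‖ + 1
  have hR₀ : ∀ x ∈ adjointBall A₀, ‖WeakDual.toStrongDual x‖ ≤ R := fun x hx => by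
    linarith [norm_le_of_mem_adjointBall hx, le_max_left ‖A₀‖ ‖A₁‖]
  have hR₁ : ∀ x ∈ adjointBall A₁, ‖WeakDual.toStrongDual x‖ ≤ R := fun x hx => by
    linarith [norm_le_of_mem_adjointBall hx, le_max_right ‖A₀‖ ‖A₁‖]
  have hR : 0 < 2 * R := by positivity
  refine SetSummable.of_subset_envelope_prod (E := InjTensor 𝕜 X₀ X₁) hq
    (Φ := fun p => tensorFunctional (WeakDual.toStrongDual p.1.1) (WeakDual.toStrongDual p.2.1))
    (isCompact_adjointBall A₀) (isCompact_adjointBall A₁)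
    (isBounded_adjointBall A₀) (isBounded_adjointBall A₁) h₀ h₁ ?_ hR ?_ ?_
  · exact continuous_tensorFunctional_apply
      (continuous_subtype_val.comp continuous_fst) (continuous_subtype_val.comp continuous_snd)
      (fun p => hR₀ _ p.1.2) fun p => hR₁ _ p.2.2
  · exact fun s t => norm_tensorFunctional_apply_sub_le (hR₁ _ s.2.2) (hR₀ _ t.1.2)
  · exact adjointBall_tensorOp_subset

theorem mainTheorem6 {𝕜 : Type*} [RCLike 𝕜]
    {X₀ X₁ Y₀ Y₁ : Type*}
    [NormedAddCommGroup X₀] [NormedSpace 𝕜 X₀] [CompleteSpace X₀]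
    [NormedAddCommGroup X₁] [NormedSpace 𝕜 X₁] [CompleteSpace X₁]
    [NormedAddCommGroup Y₀] [NormedSpace 𝕜 Y₀] [CompleteSpace Y₀]
    [NormedAddCommGroup Y₁] [NormedSpace 𝕜 Y₁] [CompleteSpace Y₁]
    (ξ : Ordinal) (q : ℝ) (hq : 1 ≤ q)
    (A₀ : X₀ →L[𝕜] Y₀) (A₁ : X₁ →L[𝕜] Y₁)
    (h₀ : Szlenk.OperatorSummable ξ q A₀) (h₁ : Szlenk.OperatorSummable ξ q A₁) :
    Szlenk.OperatorSummable ξ q (Szlenk.tensorOp A₀ A₁) :=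
  mainTheorem6_general ξ q hq A₀ A₁ h₀ h₁
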